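/- **Setting.** Let $N\ge 1$, $d\ge 1$, $T>0$, $\mathcal X=\{1,\dots,d\}$, let $\Sigma$ be the set of $\mu\in\{0,\tfrac1N,\dots,1\}^d$ with $\sum_x\mu_x=1$, and $\mathscr X=\mathcal X\times\Sigma$. For $\mu\in\Sigma$ put $n^\mu_x=N\mu_x$, and let $e_{x,z}=\frac1N(e_x-e_z)$. At a state $(x,\mu)$ the coordinates of vectors in $\mathbb R^{d-1}$ are indexed by $y\in\mathcal X\setminus\{x\}$. Given are rates $\lambda^0,\lambda^1:\mathscr X\to\mathbb R_+^{d-1}$, a terminal cost $g:\mathscr X\to\mathbb R_+$ and a running cost $\ell:\mathscr X\times\mathbb R_+^{d-1}\to\mathbb R_+$ that is continuous and strongly convex: for some $\kappa>0$, $\tau\ell(x,\mu,a')+(1-\tau)\ell(x,\mu,a)-\ell(x,\mu,\tau a'+(1-\tau)a)\ge\kappa\tau(1-\tau)|a'-a|_2^2$ for all $(x,\mu)\in\mathscr X$, $a,a'\in\mathbb R_+^{d-1}$, $\tau\in[0,1]$. An *admissible control* is a Lipschitz function $\alpha:[0,T]\times\mathscr X\to\mathbb R_+^{d-1}$. For admissible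 $\alpha,\beta$ let $(\Xi_u)$ be the time-inhomogeneous Markov chain on $\mathscr X$ with generator $\mathscr L^\alpha_x+\mathscr L^\beta_\mu$ at time $t$, where $$\mathscr L^\alpha_x\varphi(x,\mu)=\sum_{y\ne x}\big(\lambda^0_y(x,\mu)+\lambda^1_y(x,\mu)\alpha_y(t,x,\mu)\big)[\varphi(y,\mu)-\varphi(x,\mu)],$$ $$\mathscr L^\beta_\mu\varphi(x,\mu)=\sum_{y\ne z}n^\mu_z\big(\lambda^0_y(z,\mu+e_{x,z})+\lambda^1_y(z,\mu+e_{x,z})\beta_y(t,z,\mu+e_{x,z})\big)[\varphi(x,\mu+e_{y,z})-\varphi(x,\mu)],$$ and let $$v^\beta(t,x,\mu)=\inf_{\alpha\text{ admissible}}\mathbb E^{\alpha\otimes\beta}\Big[\int_t^T\ell(\Xi_u,\alpha(u,\Xi_u))\,du+g(\Xi_T)\,\Big|\,\Xi_t=(x,\mu)\Big].$$ With $\Delta_x\varphi=(\varphi(y)-\varphi(x))_{y\ne x}$, let $$H(x,\mu,p)=\inf_{a\in\mathbb R_+^{d-1}}\Big\{\ell(x,\mu,a)+\sum_{y\ne x}(\lambda^0_y(x,\mu)+\lambda^1_y(x,\mu)a_y)p_y\Big\},\qquad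 \hat\alpha(x,\mu,p)=\operatorname*{arg\,min}_{a\in\mathbb R_+^{d-1}}\Big\{\ell(x,\mu,a)+\sum_{y\neq x}a_y\lambda^1_y(x,\mu)p_y\Big\},$$ and $\alpha^*(\beta)(t,x,\mu)=\hat\alpha(x,\mu,\Delta_xv^\beta(t,\cdot,\mu))$. Let $v$ be the classical solution on $[0,T]$ of the Nash–Lasry–Lions system $$-\tfrac{d}{dt}v(t,x,\mu)=H(x,\mu,\Delta_xv(t,\cdot,\mu))+\mathscr L^{\alpha}_\mu v(t)(t,x,\mu),\quad \alpha(t,x,\mu)=\hat\alpha(x,\mu,\Delta_xv(t,\cdot,\mu)),\quad v(T,\cdot)=g.$$ For $\rho\in[0,1)$ and an admissible $\beta^{(0)}$ define, for $n\ge1$, $$v^{(n)}_\rho=v^{\beta^{(n-1)}},\qquad \beta^{(n)}=\rho\,\beta^{(n-1)}+(1-\rho)\,\alpha^*(\beta^{(n-1)}).$$ For $\varphi$ on $\mathscr X$ write $|\varphi|_2^2=\sum_{(x,\mu)\in\mathscr X}|\varphi(x,\mu)|_2^2$. **Proposition.** The Nash–Lasry–Lions system has exactly one classical solution $v$ on $[0,T]$,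 and the following hold. 1. There are $\gamma_\rho\in(0,1)$, $\rho\in(0,1)$, nondecreasing in $\rho$ with $\lim_{\rho\downarrow0}\gamma_\rho=0$, such that for every $R$ and every $\rho\in(0,1)$ there is $c_\rho>0$ with $$\sup_{t\in[0,T]}|v^{(n)}_\rho(t)-v(t)|_2\le c_\rho\,\gamma_\rho^n,\qquad n\ge1,$$ for every admissible initial control $\beta^{(0)}$ with $\sup_{t\in[0,T]}|\beta^{(0)}(t)|_2\le R$. 2. For every $R$ and every $\gamma>0$ there is $\hat c_\gamma>0$ with $$\sup_{t\in[0,T]}|v^{(n)}_0(t)-v(t)|_2\le\hat c_\gamma\,\gamma^n,\qquad n\ge1,$$ for every admissible initial control $\beta^{(0)}$ with $\sup_{t\in[0,T]}|\beta^{(0)}(t)|_2\le R$. -/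

import Mathlib

open Set Filter Topology

noncomputable section

namespace FiniteGame

/-- The control space `ℝ^(d-1)` with its Euclidean norm, where `d = m + 1` is the number of
states. At a state `x` the coordinate `i` refers to the target state `y = x.succAbove i`, that
is, `a_y` for `y < x` and `a_(y-1)` for `y > x`. -/
abbrev Ctrl (m : ℕ) := EuclideanSpace ℝ (Fin m)

/-- The discretized simplex: `μ` is represented by its counts `n_x = N μ_x`, natural numbers
with sum `N`. -/
abbrev Simplex (m N : ℕ) :=
  {k : Fin (m + 1) → ℕ // k ∈ Finset.piAntidiag (Finset.univ : Finset (Fin (m + 1))) N}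

/-- States `(x, μ)`: the position of the tagged player and the distribution of the others. -/
abbrev State (m N : ℕ) := Fin (m + 1) × Simplex m N

theorem shift_mem {m N : ℕ} (μ : Simplex m N) (y z : Fin (m + 1)) (h : μ.1 z ≠ 0) :
    (fun w => μ.1 w + (if w = y then 1 else 0) - (if w = z then 1 else 0)) ∈
      Finset.piAntidiag (Finset.univ : Finset (Fin (m + 1))) N := by
  have hμ : ∑ w, μ.1 w = N := (Finset.mem_piAntidiag.1 μ.2).1
  refine Finset.mem_piAntidiag.2 ⟨?_, fun _ _ => Finset.mem_univ _⟩
  have key : ∑ w, (μ.1 w + (if w = y then 1 else 0) - (if w = z then 1 else 0))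
      + ∑ w, (if w = z then 1 else 0) = ∑ w, μ.1 w + ∑ w, (if w = y then 1 else 0) := by
    rw [← Finset.sum_add_distrib, ← Finset.sum_add_distrib]
    refine Finset.sum_congr rfl fun w _ => ?_
    by_cases hw : w = z
    · subst hw
      simp only [if_true]
      omega
    · simp [hw]
  simp only [Finset.sum_ite_eq', Finset.mem_univ, if_true] at key
  change ∑ w, (μ.1 w + (if w = y then 1 else 0) - (if w = z then 1 else 0)) = N
  omega

/-- `μ + e_{y,z} = μ + (e_y - e_z) / N`: one player moves from `z` to `y`. If nobody is in `z`
the value is irrelevant (it only occurs with weight `n_z = 0`) and is set to `μ`. -/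
def shift {m N : ℕ} (μ : Simplex m N) (y z : Fin (m + 1)) : Simplex m N :=
  if h : μ.1 z = 0 then μ
  else ⟨fun w => μ.1 w + (if w = y then 1 else 0) - (if w = z then 1 else 0),
    shift_mem μ y z h⟩

/-- `|φ|_2 = (∑_{(x,μ)} |φ(x,μ)|_2 ^ 2) ^ (1/2)` for vector-valued functions of the state. -/
def stNorm {m N : ℕ} {V : Type*} [NormedAddCommGroup V] (φ : State m N → V) : ℝ :=
  √(∑ ξ, ‖φ ξ‖ ^ 2)

/-- The first difference vector `Δ_x φ(·, μ)` of `φ` at `x`, for fixed `μ`. -/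
def diff {m N : ℕ} (φ : State m N → ℝ) (ξ : State m N) : Fin m → ℝ :=
  fun i => φ (ξ.1.succAbove i, ξ.2) - φ ξ

end FiniteGame

/-- Data of the game with `N + 1` players and `d = m + 1` states: the horizon `T`, the fixed
rates `λ⁰`, `λ¹`, the running cost `ℓ` (only its values at controls with nonnegative coordinates
matter) and the terminal cost `g`. -/
structure FiniteGame (m N : ℕ) where
  T : ℝ
  lam0 : FiniteGame.State m N → Fin m → ℝ
  lam1 : FiniteGame.State m N → Fin m → ℝ
  cost : FiniteGame.State m N → FiniteGame.Ctrl m → ℝ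
  term : FiniteGame.State m N → ℝ

namespace FiniteGame

variable {m N : ℕ} (G : FiniteGame m N)

/-- The standing assumptions: positive horizon, nonnegative rates and costs, and a running cost
that is continuous and strongly convex in the control. -/
structure Standing : Prop where
  T_pos : 0 < G.T
  lam0_nonneg : ∀ ξ i, 0 ≤ G.lam0 ξ i
  lam1_nonneg : ∀ ξ i, 0 ≤ G.lam1 ξ i
  term_nonneg : ∀ ξ, 0 ≤ G.term ξ
  cost_nonneg : ∀ ξ (a : Ctrl m), (∀ i, 0 ≤ a i) → 0 ≤ G.cost ξ a
  cost_continuous : ∀ ξ, ContinuousOn (G.cost ξ) {a : Ctrl m | ∀ i, 0 ≤ a i}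
  cost_strongConvex : ∃ κ : ℝ, 0 < κ ∧ ∀ ξ (a a' : Ctrl m), (∀ i, 0 ≤ a i) → (∀ i, 0 ≤ a' i) →
    ∀ τ ∈ Icc (0 : ℝ) 1,
      κ * τ * (1 - τ) * ‖a' - a‖ ^ 2 ≤
        τ * G.cost ξ a' + (1 - τ) * G.cost ξ a - G.cost ξ (τ • a' + (1 - τ) • a)

/-- `(𝓛_x^a φ)(x, μ)`: jumps of the tagged player, who uses the control `a` (a function of the
state, at a fixed time). The sum over `y ≠ x` runs over `y = x.succAbove i`. -/
def genTagged (a : State m N → Ctrl m) (φ : State m N → ℝ) (ξ : State m N) : ℝ :=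
  ∑ i, (G.lam0 ξ i + G.lam1 ξ i * a ξ i) * (φ (ξ.1.succAbove i, ξ.2) - φ ξ)

/-- `(𝓛_μ^b φ)(x, μ)`: jumps of the other players, who use the control `b` (a function of the
state, at a fixed time). The sum over `z ≠ y` runs over `z` and `y = z.succAbove i`; a player
in `z` sees the tagged player in place of itself, hence the state `(z, μ + e_{x,z})`. -/
def genOthers (b : State m N → Ctrl m) (φ : State m N → ℝ) (ξ : State m N) : ℝ :=
  ∑ z, ∑ i, (ξ.2.1 z : ℝ) *
    (G.lam0 (z, shift ξ.2 ξ.1 z) i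
      + G.lam1 (z, shift ξ.2 ξ.1 z) i * b (z, shift ξ.2 ξ.1 z) i) *
    (φ (ξ.1, shift ξ.2 (z.succAbove i) z) - φ ξ)

/-- Admissible controls: Lipschitz functions `[0,T] × 𝒳 → ℝ_+^(d-1)`. The state space is finite,
so this is a Lipschitz condition in time, uniform in the state. -/
def IsAdmissible (α : ℝ → State m N → Ctrl m) : Prop :=
  (∃ K, ∀ ξ, LipschitzOnWith K (fun t => α t ξ) (Icc 0 G.T)) ∧
    ∀ t ∈ Icc 0 G.T, ∀ ξ i, 0 ≤ α t ξ i

/-- `p` is the family of distributions `p u = Law(Ξ_u | Ξ_t = ξ₀)`, `u ∈ [t,T]`, of the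
time-inhomogeneous Markov chain with generator `𝓛_x^α + 𝓛_μ^β`: it starts in `ξ₀` and solves the
Kolmogorov forward equation `d/du p_u(η) = ∑_ξ p_u(ξ) (𝓛 1_η)(ξ)`. -/
def IsChainLaw (α β : ℝ → State m N → Ctrl m) (t : ℝ) (ξ₀ : State m N)
    (p : ℝ → State m N → ℝ) : Prop :=
  p t = Pi.single ξ₀ 1 ∧
    ∀ u ∈ Icc t G.T, ∀ η, HasDerivWithinAt (fun s => p s η)
      (∑ ξ, p u ξ * (G.genTagged (α u) (Pi.single η 1) ξ + G.genOthers (β u) (Pi.single η 1) ξ))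
      (Icc t G.T) u

/-- The law of the controlled chain on `[t,T]` started from `ξ₀` at time `t`; for admissible
controls the forward equation has exactly one solution on `[t,T]`. -/
def chainLaw (α β : ℝ → State m N → Ctrl m) (t : ℝ) (ξ₀ : State m N) : ℝ → State m N → ℝ :=
  Classical.epsilon (G.IsChainLaw α β t ξ₀)

/-- The cost `J(t, ξ, α; β) = 𝔼[∫_t^T ℓ(Ξ_u, α(u, Ξ_u)) du + g(Ξ_T) | Ξ_t = ξ]`. -/
def payoff (t : ℝ) (ξ : State m N) (α β : ℝ → State m N → Ctrl m) : ℝ :=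
  (∫ u in t..G.T, ∑ η, G.chainLaw α β t ξ u η * G.cost η (α u η))
    + ∑ η, G.chainLaw α β t ξ G.T η * G.term η

/-- The value function `v^β(t, ξ) = inf_α J(t, ξ, α; β)` over admissible `α`. -/
def value (β : ℝ → State m N → Ctrl m) (t : ℝ) (ξ : State m N) : ℝ :=
  ⨅ α : {α : ℝ → State m N → Ctrl m // G.IsAdmissible α}, G.payoff t ξ α.1 β

/-- The Hamiltonian `H(ξ, p)`. -/
def hamiltonian (ξ : State m N) (p : Fin m → ℝ) : ℝ :=
  ⨅ a : {a : Ctrl m // ∀ i, 0 ≤ a i},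
    (G.cost ξ a.1 + ∑ i, (G.lam0 ξ i + G.lam1 ξ i * a.1 i) * p i)

/-- The minimizer `α̂(ξ, p)` of `a ↦ ℓ(ξ, a) + ∑_y λ¹_y(ξ) a_y p_y` over `ℝ_+^(d-1)`; it exists
and is unique under the standing assumptions. -/
def argmin (ξ : State m N) (p : Fin m → ℝ) : Ctrl m :=
  Classical.epsilon fun a : Ctrl m => (∀ i, 0 ≤ a i) ∧
    IsMinOn (fun a : Ctrl m => G.cost ξ a + ∑ i, a i * G.lam1 ξ i * p i)
      {a : Ctrl m | ∀ i, 0 ≤ a i} a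

/-- The feedback `ξ ↦ α̂(ξ, Δ_x φ(·, μ))`, `ξ = (x, μ)`, induced by a function `φ` of the state. -/
def feedback (φ : State m N → ℝ) (ξ : State m N) : Ctrl m :=
  G.argmin ξ (diff φ ξ)

/-- The best response `α*(β)` of the tagged player. -/
def bestResponse (β : ℝ → State m N → Ctrl m) (t : ℝ) : State m N → Ctrl m :=
  G.feedback (G.value β t)

/-- Classical solutions on `[0,T]` of the Nash-Lasry-Lions system. -/
def IsNLLSolution (v : ℝ → State m N → ℝ) : Prop :=
  (∀ ξ, v G.T ξ = G.term ξ) ∧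
    ∀ t ∈ Icc 0 G.T, ∀ ξ, HasDerivWithinAt (fun s => v s ξ)
      (-(G.hamiltonian ξ (diff (v t) ξ) + G.genOthers (G.feedback (v t)) (v t) ξ))
      (Icc 0 G.T) t

/-- The control `β^(n)` of the other players in the iteration with weight `ρ`:
`β^(n+1) = ρ β^(n) + (1 - ρ) α*(β^(n))`. -/
def iterControl (ρ : ℝ) (β₀ : ℝ → State m N → Ctrl m) : ℕ → ℝ → State m N → Ctrl m
  | 0 => β₀
  | n + 1 => fun t ξ =>
      ρ • iterControl ρ β₀ n t ξ + (1 - ρ) • G.bestResponse (iterControl ρ β₀ n) t ξ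

/-- The value function `v^(n) = v^{β^(n-1)}`, meaningful for `n ≥ 1`. -/
def iterValue (ρ : ℝ) (β₀ : ℝ → State m N → Ctrl m) (n : ℕ) : ℝ → State m N → ℝ :=
  G.value (G.iterControl ρ β₀ (n - 1))

/-- `β` is admissible and `sup_{t ∈ [0,T]} |β(t)|_2 ≤ R`. -/
def IsAdmissibleBdd (R : ℝ) (β : ℝ → State m N → Ctrl m) : Prop :=
  G.IsAdmissible β ∧ ∀ t ∈ Icc 0 G.T, stNorm (β t) ≤ R

end FiniteGame

end

/-! The state space is finite, so all the equations are ordinary differential equations. Strong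
convexity makes `argmin` exist and be Lipschitz in `p`, so `feedback` is Lipschitz in the value
function. The backward systems then have locally Lipschitz fields. The maximum principle gives the a
priori bound `valueBound`, which does not depend on the controls, and so solutions exist on all of
`[0,T]`. Verification through the forward equation identifies `value β` with the solution of the
equation driven by `β`.

Convergence is a contraction in the weighted norm `sup_t exp(-lam (T - t)) ‖·‖`. If `β` is within
`B` of the equilibrium feedback in this norm, `exists_value_stability` puts `value β` within `K B /
(lam - K)` of `v`, with `K` independent of `β`. Composed with the Lipschitz feedback, the best
response has error at most `q B`, and `q > 0` is as small as desired once `lam` is large. Averaging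
with weight `ρ` gives the factor `ρ + (1 - ρ) q ≤ ρ + q` per step (`exists_iterValue_bound`).
Changing back to the unweighted norm costs only a constant. For `ρ = 0` every positive rate is
reached; for `ρ > 0` the choice `q = ρ (1 - ρ)` keeps the rate below one. -/

/-! ### Ordinary differential equations and comparison principles -/

/-- Truncation of every coordinate to `[-M, M]`. -/
noncomputable def clip {ι : Type*} (M : ℝ) (x : ι → ℝ) : ι → ℝ := fun i => max (-M) (min M (x i))

theorem clip_mono {ι : Type*} (M : ℝ) {x : ι → ℝ} {i j : ι} (h : x i ≤ x j) : clip M x i ≤ clip M x j :=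
  max_le_max le_rfl (min_le_min le_rfl h)

section Clip

variable {ι : Type*} [Fintype ι]

theorem norm_clip_le {M : ℝ} (hM : 0 ≤ M) (x : ι → ℝ) : ‖clip M x‖ ≤ M := by
  refine (pi_norm_le_iff_of_nonneg hM).2 fun i => ?_
  rw [Real.norm_eq_abs, abs_le]
  exact ⟨le_max_left _ _, max_le (by linarith) (min_le_left _ _)⟩

theorem norm_clip_sub_clip_le (M : ℝ) (x y : ι → ℝ) : ‖clip M x - clip M y‖ ≤ ‖x - y‖ := by
  refine (pi_norm_le_iff_of_nonneg (norm_nonneg _)).2 fun i => ?_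
  refine le_trans ?_ (norm_le_pi_norm (x - y) i)
  simp only [clip, Pi.sub_apply, Real.norm_eq_abs]
  refine (abs_max_sub_max_le_max _ _ _ _).trans ?_
  rw [sub_self, abs_zero]
  refine max_le (abs_nonneg _) ((abs_min_sub_min_le_max _ _ _ _).trans ?_)
  simp

theorem clip_eq_self {M : ℝ} {x : ι → ℝ} (hx : ‖x‖ ≤ M) : clip M x = x := by
  funext i
  have h := (norm_le_pi_norm x i).trans hx
  rw [Real.norm_eq_abs, abs_le] at h
  simp [clip, h.1, h.2]

/-- Global existence for the truncation of a locally Lipschitz vector field. -/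
theorem exists_solution_clip {F : ℝ → (ι → ℝ) → ι → ℝ} {a b t₀ M K : ℝ} (ht₀ : t₀ ∈ Icc a b)
    (hM : 0 ≤ M) (hK : 0 ≤ K) (x₀ : ι → ℝ)
    (hF : ∀ t ∈ Icc a b, ∀ x y, ‖x‖ ≤ M → ‖y‖ ≤ M → ‖F t x - F t y‖ ≤ K * ‖x - y‖)
    (hc : ∀ x, ‖x‖ ≤ M → ContinuousOn (fun t => F t x) (Icc a b)) :
    ∃ φ : ℝ → ι → ℝ, φ t₀ = x₀ ∧
      ∀ t ∈ Icc a b, HasDerivWithinAt φ (F t (clip M (φ t))) (Icc a b) t := by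
  obtain ⟨C, hC⟩ := isCompact_Icc.exists_bound_of_continuousOn (hc 0 (by simpa using hM))
  have hC0 : 0 ≤ C := (norm_nonneg _).trans (hC t₀ ht₀)
  set L : ℝ := C + K * M with hL
  have hL0 : 0 ≤ L := by positivity
  -- The truncated field is bounded by `L` on the whole space, so no solution leaves the ball of
  -- radius `A` during `[a,b]`, and the local existence theorem covers the whole interval.
  set A : ℝ := L * max (b - t₀) (t₀ - a) with hA
  have hA0 : 0 ≤ A := mul_nonneg hL0 (le_max_of_le_left (by linarith [ht₀.2]))
  have hbound : ∀ t ∈ Icc a b, ∀ x, ‖F t (clip M x)‖ ≤ L := by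
    intro t ht x
    have h1 := hF t ht (clip M x) 0 (norm_clip_le hM x) (by simpa using hM)
    have h2 : ‖F t (clip M x)‖ ≤ ‖F t (clip M x) - F t 0‖ + ‖F t 0‖ := by
      simpa using norm_add_le (F t (clip M x) - F t 0) (F t 0)
    rw [sub_zero] at h1
    have h3 := mul_le_mul_of_nonneg_left (norm_clip_le hM x) hK
    linarith [hC t ht]
  have hPL : IsPicardLindelof (fun t x => F t (clip M x)) (⟨t₀, ht₀⟩ : Icc a b) x₀
      (.mk A hA0) 0 (.mk L hL0) (.mk K hK) := by
    refine ⟨fun t ht => ?_, fun x _ => hc _ (norm_clip_le hM x), fun t ht x _ => hbound t ht x, ?_⟩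
    · refine LipschitzOnWith.of_dist_le_mul fun x _ y _ => ?_
      rw [dist_eq_norm, dist_eq_norm]
      exact (hF t ht _ _ (norm_clip_le hM x) (norm_clip_le hM y)).trans
        (mul_le_mul_of_nonneg_left (norm_clip_sub_clip_le M x y) hK)
    · simp only [hA, NNReal.coe_mk, NNReal.coe_zero, sub_zero]
      exact le_rfl
  exact hPL.exists_eq_forall_mem_Icc_hasDerivWithinAt₀

end Clip

/-! ### Maximum principles backward in time -/

theorem HasDerivWithinAt.Ici_of_Icc {E : Type*} [NormedAddCommGroup E] [NormedSpace ℝ E]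
    {f : ℝ → E} {f' : E} {a b t : ℝ}
    (h : HasDerivWithinAt f f' (Icc a b) t) (ht : t ∈ Ico a b) : HasDerivWithinAt f f' (Ici t) t :=
  h.mono_of_mem_nhdsWithin (mem_of_superset (Icc_mem_nhdsGE ht.2) (Icc_subset_Icc_left ht.1))

/-- If the right derivative at a right-sided maximum exists, it is nonpositive. -/
theorem HasDerivWithinAt.nonpos_of_forall_le {f : ℝ → ℝ} {f' t b : ℝ} (htb : t < b)
    (h : HasDerivWithinAt f f' (Ici t) t) (hmax : ∀ s ∈ Icc t b, f s ≤ f t) : f' ≤ 0 := by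
  by_contra! hpos
  have h1 := (hasDerivWithinAt_iff_tendsto_slope.1 h).eventually (lt_mem_nhds hpos)
  have h2 : ∀ᶠ s in 𝓝[Ici t \ {t}] t, s ∈ Icc t b :=
    (nhdsWithin_mono t sdiff_subset) (Icc_mem_nhdsGE htb)
  have h3 : (𝓝[Ici t \ {t}] t).NeBot := by
    rw [Ici_sdiff_left]; infer_instance
  obtain ⟨s, hs1, hs2, hs3⟩ := (h1.and (h2.and self_mem_nhdsWithin)).exists
  have hs4 : t < s := lt_of_le_of_ne hs2.1 (Ne.symm hs3.2)
  rw [slope_def_field] at hs1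
  have := hmax s hs2
  have h5 : (f s - f t) / (s - t) ≤ 0 := div_nonpos_of_nonpos_of_nonneg (by linarith) (by linarith)
  linarith

/-- Backward maximum principle for a finite family of functions. -/
theorem le_of_deriv_pos_of_isMax {ι : Type*} [Finite ι] {f f' : ι → ℝ → ℝ} {a b C : ℝ}
    (hf : ∀ i, ∀ t ∈ Icc a b, HasDerivWithinAt (f i) (f' i t) (Icc a b) t)
    (hb : ∀ i, f i b ≤ C)
    (hpos : ∀ t ∈ Ico a b, ∀ i, (∀ j, f j t ≤ f i t) → C < f i t → 0 < f' i t) :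
    ∀ t ∈ Icc a b, ∀ i, f i t ≤ C := by
  intro t₁ ht₁ i₁
  have := Nonempty.intro i₁
  -- The maximum is taken over time and index together. If it exceeded `C` it would lie before `b`,
  -- where the right derivative is nonpositive, against `hpos`.
  have hmax : ∀ i, ∃ t ∈ Icc a b, ∀ s ∈ Icc a b, f i s ≤ f i t := fun i =>
    isCompact_Icc.exists_isMaxOn ⟨t₁, ht₁⟩ fun t ht => (hf i t ht).continuousWithinAt
  choose τ hτ hτmax using hmax
  obtain ⟨i, hi⟩ := Finite.exists_max fun i => f i (τ i)
  by_contra! hC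
  have hCi : C < f i (τ i) := hC.trans_le ((hτmax i₁ t₁ ht₁).trans (hi i₁))
  have hne : τ i < b := lt_of_le_of_ne (hτ i).2 fun h => by
    have := hb i
    rw [← h] at this
    linarith
  have h1 := hpos (τ i) ⟨(hτ i).1, hne⟩ i
    (fun j => (hτmax j _ (hτ i)).trans (hi j)) hCi
  have h2 := ((hf i _ (hτ i)).Ici_of_Icc ⟨(hτ i).1, hne⟩).nonpos_of_forall_le hne
    fun s hs => hτmax i s ⟨(hτ i).1.trans hs.1, hs.2⟩
  linarith

/-- Backward maximum principle for the absolute value of a finite family of functions. -/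
theorem abs_le_of_deriv_pos_of_isMax {ι : Type*} [Finite ι] {f f' : ι → ℝ → ℝ} {a b C : ℝ}
    (hf : ∀ i, ∀ t ∈ Icc a b, HasDerivWithinAt (f i) (f' i t) (Icc a b) t)
    (hb : ∀ i, |f i b| ≤ C)
    (hpos : ∀ t ∈ Ico a b, ∀ i, (∀ j, |f j t| ≤ f i t) → C < f i t → 0 < f' i t)
    (hneg : ∀ t ∈ Ico a b, ∀ i, (∀ j, |f j t| ≤ -f i t) → C < -f i t → f' i t < 0) :
    ∀ t ∈ Icc a b, ∀ i, |f i t| ≤ C := by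
  -- Doubling the index set treats `f i` and `-f i` as one family, so a maximal member dominates all
  -- absolute values.
  have key := le_of_deriv_pos_of_isMax (ι := ι × Bool)
    (f := fun p t => if p.2 then f p.1 t else -f p.1 t)
    (f' := fun p t => if p.2 then f' p.1 t else -f' p.1 t) (a := a) (b := b) (C := C) ?_ ?_ ?_
  · intro t ht i
    have h1 := key t ht (i, true)
    have h2 := key t ht (i, false)
    simp only [if_true, Bool.false_eq_true, if_false] at h1 h2
    exact abs_le.2 ⟨by linarith, h1⟩
  · rintro ⟨i, _ | _⟩ t ht
    · simp only [Bool.false_eq_true, if_false]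
      exact (hf i t ht).neg
    · simpa using hf i t ht
  · rintro ⟨i, _ | _⟩
    · simpa using (neg_le_abs _).trans (hb i)
    · simpa using (le_abs_self _).trans (hb i)
  · rintro t ht ⟨i, _ | _⟩ h1 h2
    · simp only [Bool.false_eq_true, if_false, Left.neg_pos_iff] at h1 h2 ⊢
      refine hneg t ht i (fun j => abs_le.2 ⟨?_, ?_⟩) h2
      · have := h1 (j, false)
        simp only [Bool.false_eq_true, if_false] at this
        linarith
      · simpa using h1 (j, true)
    · simp only [if_true] at h1 h2 ⊢
      refine hpos t ht i (fun j => abs_le.2 ⟨?_, ?_⟩) h2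
      · have := h1 (j, false)
        simp only [Bool.false_eq_true, if_false] at this
        linarith
      · simpa using h1 (j, true)

/-- A backward Gronwall inequality with exponential weight. -/
theorem norm_le_of_deriv_bound_backward {ι : Type*} [Fintype ι] {d d' : ℝ → ι → ℝ}
    {a b K E lam : ℝ} (hE : 0 ≤ E) (hlam : K < lam)
    (hd : ∀ i, ∀ t ∈ Icc a b, HasDerivWithinAt (fun s => d s i) (d' t i) (Icc a b) t)
    (hb : d b = 0)
    (hbound : ∀ t ∈ Icc a b, ∀ i, |d' t i| ≤ K * ‖d t‖ + E * Real.exp (lam * (b - t))) :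
    ∀ t ∈ Icc a b, ‖d t‖ ≤ E / (lam - K) * Real.exp (lam * (b - t)) := by
  have hlK : 0 < lam - K := sub_pos.2 hlam
  have hC : 0 ≤ E / (lam - K) := by positivity
  set e : ℝ → ℝ := fun t => Real.exp (-(lam * (b - t))) with he
  have hepos : ∀ t, 0 < e t := fun t => Real.exp_pos _
  have hee : ∀ t, e t * Real.exp (lam * (b - t)) = 1 := fun t => by
    rw [he, ← Real.exp_add]; simp
  have hde : ∀ t, HasDerivAt e (lam * e t) t := fun t => by
    have h1 : HasDerivAt (fun t => -(lam * (b - t))) lam t := by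
      have := (((hasDerivAt_id' t).const_sub b).const_mul lam).fun_neg
      simpa using this
    simpa [he, mul_comm] using h1.exp
  -- Above the level `E / (lam - K)` the growth `lam` of the weight beats the derivative: `K x + E <
  -- lam x` for `x = e t * ‖d t‖`.
  have hcore : ∀ t ∈ Icc a b, E / (lam - K) < e t * ‖d t‖ → ∀ i,
      e t * |d' t i| < e t * (lam * ‖d t‖) := by
    intro t ht h i
    have h1 := mul_le_mul_of_nonneg_left (hbound t ht i) (hepos t).le
    have h2 : e t * (K * ‖d t‖ + E * Real.exp (lam * (b - t))) = K * (e t * ‖d t‖) + E := by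
      linear_combination E * hee t
    rw [div_lt_iff₀ hlK] at h
    nlinarith
  have hsup : ∀ t i, ∀ x : ℝ, (∀ j, |e t * d t j| ≤ x) → x ≤ |e t * d t i| →
      x = e t * ‖d t‖ := by
    intro t i x hx hxi
    have h0 : 0 ≤ x := (abs_nonneg _).trans (hx i)
    refine le_antisymm ?_ ?_
    · rw [abs_mul, abs_of_pos (hepos t)] at hxi
      exact hxi.trans (mul_le_mul_of_nonneg_left (norm_le_pi_norm (d t) i) (hepos t).le)
    · rw [← le_div_iff₀' (hepos t)]
      refine (pi_norm_le_iff_of_nonneg (div_nonneg h0 (hepos t).le)).2 fun j => ?_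
      rw [le_div_iff₀' (hepos t)]
      have := hx j
      rwa [abs_mul, abs_of_pos (hepos t)] at this
  have key := abs_le_of_deriv_pos_of_isMax (ι := ι) (f := fun i t => e t * d t i)
    (f' := fun i t => lam * e t * d t i + e t * d' t i) (a := a) (b := b) (C := E / (lam - K))
    (fun i t ht => (hde t).hasDerivWithinAt.mul (hd i t ht)) (fun i => by simpa [hb] using hC)
    ?_ ?_
  · intro t ht
    refine (pi_norm_le_iff_of_nonneg (by positivity)).2 fun i => ?_
    have h := mul_le_mul_of_nonneg_right (key t ht i) (Real.exp_pos (lam * (b - t))).le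
    rw [abs_mul, abs_of_pos (hepos t)] at h
    calc ‖d t i‖ = e t * |d t i| * Real.exp (lam * (b - t)) := by
          rw [Real.norm_eq_abs]; linear_combination (-|d t i|) * hee t
      _ ≤ _ := h
  · intro t ht i h1 h2
    have h3 := hsup t i _ h1 (le_abs_self _)
    have h4 := hcore t (Ico_subset_Icc_self ht) (h3 ▸ h2) i
    have h5 := mul_le_mul_of_nonneg_left (neg_abs_le (d' t i)) (hepos t).le
    linear_combination h4 + h5 - lam * h3
  · intro t ht i h1 h2
    have h3 := hsup t i _ h1 (neg_le_abs _)
    have h4 := hcore t (Ico_subset_Icc_self ht) (h3 ▸ h2) i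
    have h5 := mul_le_mul_of_nonneg_left (le_abs_self (d' t i)) (hepos t).le
    linear_combination h4 + h5 - lam * h3

/-- A function whose right derivative is nonnegative wherever it is negative stays nonnegative. -/
theorem nonneg_of_deriv_nonneg_of_neg {f f' : ℝ → ℝ} {a b : ℝ}
    (hf : ∀ t ∈ Icc a b, HasDerivWithinAt f (f' t) (Icc a b) t) (ha : 0 ≤ f a)
    (h : ∀ t ∈ Icc a b, f t < 0 → 0 ≤ f' t) : ∀ t ∈ Icc a b, 0 ≤ f t := by
  intro t ht
  refine le_of_forall_pos_le_add fun ε hε => ?_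
  -- The comparison function for `-f` is a line with positive slope, scaled to equal `ε` at `t`.
  -- Where `-f` meets it, `f` is negative, so `-f` cannot cross.
  have hB : ∀ x, HasDerivAt (fun s => ε / (1 + (t - a)) * (1 + (s - a))) (ε / (1 + (t - a))) x :=
    fun x => by
      simpa using (((hasDerivAt_id x).sub_const a).const_add 1).const_mul (ε / (1 + (t - a)))
  have hpos : 0 < 1 + (t - a) := by linarith [ht.1]
  have hq : 0 < ε / (1 + (t - a)) := div_pos hε hpos
  have key := image_le_of_deriv_right_lt_deriv_boundary (f := fun s => -f s)
    (f' := fun s => -f' s) (a := a) (b := b)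
    (fun s hs => (hf s hs).continuousWithinAt.neg)
    (fun s hs => ((hf s (Ico_subset_Icc_self hs)).Ici_of_Icc hs).neg)
    (by simp only [sub_self, add_zero, mul_one]; linarith) hB
    (fun s hs heq => by
      have h0 : 0 < ε / (1 + (t - a)) * (1 + (s - a)) := mul_pos hq (by linarith [hs.1])
      have := h s (Ico_subset_Icc_self hs) (by linarith)
      linarith) ht
  simp only [div_mul_cancel₀ ε hpos.ne'] at key
  linarith

namespace FiniteGame

variable {m N : ℕ} {G : FiniteGame m N}

/-! ### The minimizer and the Hamiltonian -/

theorem abs_sum_mul_mul_le {ι : Type*} [Fintype ι] (c p : ι → ℝ) (a : EuclideanSpace ℝ ι) :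
    |∑ i, c i * a i * p i| ≤ (∑ i, |c i|) * ‖a‖ * ‖p‖ := by
  refine (Finset.abs_sum_le_sum_abs _ _).trans ?_
  rw [Finset.sum_mul, Finset.sum_mul]
  refine Finset.sum_le_sum fun i _ => ?_
  rw [abs_mul, abs_mul]
  have h1 : |a i| ≤ ‖a‖ := PiLp.norm_apply_le a i
  have h2 : |p i| ≤ ‖p‖ := norm_le_pi_norm p i
  gcongr

theorem abs_sum_mul_le {ι : Type*} [Fintype ι] (c p : ι → ℝ) :
    |∑ i, c i * p i| ≤ (∑ i, |c i|) * ‖p‖ := by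
  refine (Finset.abs_sum_le_sum_abs _ _).trans ?_
  rw [Finset.sum_mul]
  refine Finset.sum_le_sum fun i _ => ?_
  rw [abs_mul]
  exact mul_le_mul_of_nonneg_left (norm_le_pi_norm p i) (abs_nonneg _)

theorem isClosed_nonneg (m : ℕ) : IsClosed {a : Ctrl m | ∀ i, 0 ≤ a i} := by
  simp only [ofPred_forall]
  exact isClosed_iInter fun i => isClosed_le continuous_const (by fun_prop)

/-- The objective is coercive: strong convexity between `0` and `a`, tested at the unit vector `a /
‖a‖`, where the cost is nonnegative, forces quadratic growth, and this beats the linear term. -/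
theorem Standing.exists_minimizer (hG : G.Standing) (ξ : State m N) (p : Fin m → ℝ) :
    ∃ a : Ctrl m, (∀ i, 0 ≤ a i) ∧
      IsMinOn (fun a : Ctrl m => G.cost ξ a + ∑ i, a i * G.lam1 ξ i * p i)
        {a : Ctrl m | ∀ i, 0 ≤ a i} a := by
  obtain ⟨κ, hκ, hconv⟩ := hG.cost_strongConvex
  set f : Ctrl m → ℝ := fun a => G.cost ξ a + ∑ i, a i * G.lam1 ξ i * p i with hf
  have hc0 : 0 ≤ G.cost ξ 0 := hG.cost_nonneg ξ 0 (by simp)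
  set C : ℝ := (∑ i, |G.lam1 ξ i|) * ‖p‖ with hC
  have hC0 : 0 ≤ C := by positivity
  have hlin : ∀ a : Ctrl m, |∑ i, a i * G.lam1 ξ i * p i| ≤ C * ‖a‖ := fun a => by
    have := abs_sum_mul_mul_le (G.lam1 ξ) p a
    simp only [mul_comm (G.lam1 ξ _)] at this
    linarith
  have hcont : ContinuousOn f {a : Ctrl m | ∀ i, 0 ≤ a i} :=
    (hG.cost_continuous ξ).add (Continuous.continuousOn (by fun_prop))
  refine hcont.exists_isMinOn' (isClosed_nonneg m) (x₀ := 0) (by simp) ?_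
  -- At this radius `κ (‖a‖ - 1) ≥ 2 ℓ(0) + C`: one `ℓ(0)` absorbs the convexity remainder, `C`
  -- absorbs the linear term, and the other `ℓ(0)` is the value to be exceeded.
  have hlarge : ∀ᶠ a in cocompact (Ctrl m), 1 + (2 * G.cost ξ 0 + C) / κ ≤ ‖a‖ :=
    (tendsto_norm_cocompact_atTop).eventually_ge_atTop _
  filter_upwards [hlarge.filter_mono inf_le_left, mem_inf_of_right (mem_principal_self _)]
    with a ha hpos
  have hr : 1 ≤ ‖a‖ := le_trans (le_add_of_nonneg_right (by positivity)) ha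
  have hr0 : 0 < ‖a‖ := by linarith
  have hτ : ‖a‖⁻¹ ∈ Icc (0 : ℝ) 1 := ⟨by positivity, inv_le_one_of_one_le₀ hr⟩
  have h1 := hconv ξ 0 a (by simp) hpos _ hτ
  have h2 : 0 ≤ G.cost ξ (‖a‖⁻¹ • a + (1 - ‖a‖⁻¹) • 0) := by
    refine hG.cost_nonneg ξ _ fun i => ?_
    simpa using mul_nonneg hτ.1 (hpos i)
  rw [sub_zero] at h1
  have h3 : κ * (‖a‖ - 1) * ‖a‖ ≤ G.cost ξ a + ‖a‖ * G.cost ξ 0 := by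
    have h4 : κ * ‖a‖⁻¹ * (1 - ‖a‖⁻¹) * ‖a‖ ^ 2 = κ * (‖a‖ - 1) := by
      field_simp
    have h5 : ‖a‖⁻¹ * G.cost ξ 0 ≥ 0 := mul_nonneg hτ.1 hc0
    have h6 : κ * (‖a‖ - 1) ≤ ‖a‖⁻¹ * G.cost ξ a + G.cost ξ 0 := by linarith
    have h7 := mul_le_mul_of_nonneg_right h6 hr0.le
    have h8 : (‖a‖⁻¹ * G.cost ξ a + G.cost ξ 0) * ‖a‖ = G.cost ξ a + ‖a‖ * G.cost ξ 0 := by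
      field_simp
    linarith
  have h9 : 2 * G.cost ξ 0 + C ≤ κ * (‖a‖ - 1) := by
    rw [← div_le_iff₀' hκ]; linarith
  have h10 := mul_le_mul_of_nonneg_right h9 hr0.le
  have h11 := neg_le_of_abs_le (hlin a)
  have h12 : f 0 = G.cost ξ 0 := by simp [hf]
  have h13 : G.cost ξ 0 ≤ ‖a‖ * G.cost ξ 0 := le_mul_of_one_le_left hc0 hr
  rw [h12]
  change _ ≤ G.cost ξ a + ∑ i, a i * G.lam1 ξ i * p i
  linarith

theorem Standing.argmin_nonneg (hG : G.Standing) (ξ : State m N) (p : Fin m → ℝ) (i : Fin m) :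
    0 ≤ G.argmin ξ p i :=
  (Classical.epsilon_spec (hG.exists_minimizer ξ p)).1 i

theorem Standing.argmin_le (hG : G.Standing) (ξ : State m N) (p : Fin m → ℝ) {a : Ctrl m}
    (ha : ∀ i, 0 ≤ a i) :
    G.cost ξ (G.argmin ξ p) + ∑ i, G.argmin ξ p i * G.lam1 ξ i * p i ≤
      G.cost ξ a + ∑ i, a i * G.lam1 ξ i * p i :=
  (Classical.epsilon_spec (hG.exists_minimizer ξ p)).2 ha

/-- Quadratic growth at the minimizer, uniformly in the state and in `p`. -/
theorem Standing.exists_argmin_growth (hG : G.Standing) :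
    ∃ κ : ℝ, 0 < κ ∧ ∀ ξ p (a : Ctrl m), (∀ i, 0 ≤ a i) →
      G.cost ξ (G.argmin ξ p) + ∑ i, G.argmin ξ p i * G.lam1 ξ i * p i
        + κ * ‖a - G.argmin ξ p‖ ^ 2 ≤ G.cost ξ a + ∑ i, a i * G.lam1 ξ i * p i := by
  obtain ⟨κ, hκ, hconv⟩ := hG.cost_strongConvex
  refine ⟨κ / 2, by positivity, fun ξ p a ha => ?_⟩
  set b := G.argmin ξ p with hb
  have hb0 : ∀ i, 0 ≤ b i := hG.argmin_nonneg ξ p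
  -- The midpoint of `a` and `b` cannot beat the minimizer `b`; the convexity gain there, multiplied
  -- by two, is the quadratic term with `κ / 2`.
  have h1 := hconv ξ b a hb0 ha (1 / 2) ⟨by norm_num, by norm_num⟩
  have h2 := hG.argmin_le ξ p (a := (1 / 2 : ℝ) • a + (1 - 1 / 2 : ℝ) • b) fun i => by
    have := ha i
    have := hb0 i
    simp only [PiLp.add_apply, PiLp.smul_apply, smul_eq_mul]
    linarith
  rw [← hb] at h2
  have h3 : ∑ i, ((1 / 2 : ℝ) • a + (1 - 1 / 2 : ℝ) • b) i * G.lam1 ξ i * p i =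
      1 / 2 * ∑ i, a i * G.lam1 ξ i * p i + 1 / 2 * ∑ i, b i * G.lam1 ξ i * p i := by
    rw [Finset.mul_sum, Finset.mul_sum, ← Finset.sum_add_distrib]
    refine Finset.sum_congr rfl fun i _ => ?_
    simp only [PiLp.add_apply, PiLp.smul_apply, smul_eq_mul]
    ring
  linarith

/-- Adding the growth inequalities at `p` and at `q`, each tested with the other minimizer, cancels
the costs and leaves `2 κ ‖a - b‖²` below a pairing of `a - b` with `p - q`. Summing the rates over
all states makes the constant uniform. -/
theorem Standing.exists_argmin_lipschitz (hG : G.Standing) :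
    ∃ K : ℝ, 0 ≤ K ∧ ∀ ξ p q, ‖G.argmin ξ p - G.argmin ξ q‖ ≤ K * ‖p - q‖ := by
  obtain ⟨κ, hκ, hgrow⟩ := hG.exists_argmin_growth
  refine ⟨(∑ ξ, ∑ i, |G.lam1 ξ i|) / (2 * κ), by positivity, fun ξ p q => ?_⟩
  set a := G.argmin ξ p with ha
  set b := G.argmin ξ q with hb
  have h1 := hgrow ξ p b (hG.argmin_nonneg ξ q)
  have h2 := hgrow ξ q a (hG.argmin_nonneg ξ p)
  rw [← ha] at h1
  rw [← hb] at h2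
  have h3 := (neg_le_abs _).trans (abs_sum_mul_mul_le (G.lam1 ξ) (p - q) (a - b))
  have h4 : ∑ i, G.lam1 ξ i * (a - b) i * (p - q) i =
      (∑ i, a i * G.lam1 ξ i * p i - ∑ i, b i * G.lam1 ξ i * p i)
        - (∑ i, a i * G.lam1 ξ i * q i - ∑ i, b i * G.lam1 ξ i * q i) := by
    simp only [← Finset.sum_sub_distrib]
    refine Finset.sum_congr rfl fun i _ => ?_
    simp only [PiLp.sub_apply, Pi.sub_apply]
    ring
  have h5 : ∑ i, |G.lam1 ξ i| ≤ ∑ ξ, ∑ i, |G.lam1 ξ i| :=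
    Finset.single_le_sum (f := fun ξ => ∑ i, |G.lam1 ξ i|) (fun ξ _ => by positivity)
      (Finset.mem_univ ξ)
  have h6 : (∑ i, |G.lam1 ξ i|) * ‖a - b‖ * ‖p - q‖ ≤
      (∑ ξ, ∑ i, |G.lam1 ξ i|) * ‖a - b‖ * ‖p - q‖ := by gcongr
  rw [norm_sub_rev b a] at h1
  have h7 : ‖a - b‖ * (2 * κ * ‖a - b‖) ≤ ‖a - b‖ * ((∑ ξ, ∑ i, |G.lam1 ξ i|) * ‖p - q‖) := by
    linarith
  rw [div_mul_eq_mul_div, le_div_iff₀ (by positivity)]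
  rcases (norm_nonneg (a - b)).eq_or_lt with h0 | h0
  · rw [← h0, zero_mul]; positivity
  · linarith [le_of_mul_le_mul_left h7 h0]

/-- The `lam0` part does not involve the control, so `argmin` also minimizes the objective of the
Hamiltonian. -/
theorem hamiltonian_objective_eq (ξ : State m N) (p : Fin m → ℝ) (a : Ctrl m) :
    G.cost ξ a + ∑ i, (G.lam0 ξ i + G.lam1 ξ i * a i) * p i =
      G.cost ξ a + ∑ i, a i * G.lam1 ξ i * p i + ∑ i, G.lam0 ξ i * p i := by
  rw [add_assoc, ← Finset.sum_add_distrib]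
  congr 1
  exact Finset.sum_congr rfl fun i _ => by ring

theorem Standing.argmin_le_objective (hG : G.Standing) (ξ : State m N) (p : Fin m → ℝ)
    {a : Ctrl m} (ha : ∀ i, 0 ≤ a i) :
    G.cost ξ (G.argmin ξ p) + ∑ i, (G.lam0 ξ i + G.lam1 ξ i * G.argmin ξ p i) * p i ≤
      G.cost ξ a + ∑ i, (G.lam0 ξ i + G.lam1 ξ i * a i) * p i := by
  rw [hamiltonian_objective_eq, hamiltonian_objective_eq]
  linarith [hG.argmin_le ξ p ha]

theorem Standing.hamiltonian_le (hG : G.Standing) (ξ : State m N) (p : Fin m → ℝ) {a : Ctrl m}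
    (ha : ∀ i, 0 ≤ a i) :
    G.hamiltonian ξ p ≤ G.cost ξ a + ∑ i, (G.lam0 ξ i + G.lam1 ξ i * a i) * p i :=
  ciInf_le (f := fun a : {a : Ctrl m // ∀ i, 0 ≤ a i} =>
      G.cost ξ a.1 + ∑ i, (G.lam0 ξ i + G.lam1 ξ i * a.1 i) * p i)
    ⟨_, forall_mem_range.2 fun a => hG.argmin_le_objective ξ p a.2⟩ ⟨a, ha⟩

theorem Standing.hamiltonian_eq (hG : G.Standing) (ξ : State m N) (p : Fin m → ℝ) :
    G.hamiltonian ξ p = G.cost ξ (G.argmin ξ p)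
      + ∑ i, (G.lam0 ξ i + G.lam1 ξ i * G.argmin ξ p i) * p i := by
  have : Nonempty {a : Ctrl m // ∀ i, 0 ≤ a i} := ⟨⟨_, hG.argmin_nonneg ξ p⟩⟩
  exact le_antisymm (hG.hamiltonian_le ξ p (hG.argmin_nonneg ξ p))
    (le_ciInf fun a => hG.argmin_le_objective ξ p a.2)

/-- This sign information is used at a state where the value function is minimal; its counterpart
for a maximal state follows from testing with the zero control. -/
theorem Standing.hamiltonian_nonneg (hG : G.Standing) (ξ : State m N) {p : Fin m → ℝ}
    (hp : ∀ i, 0 ≤ p i) : 0 ≤ G.hamiltonian ξ p := by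
  rw [hG.hamiltonian_eq]
  refine add_nonneg (hG.cost_nonneg ξ _ (hG.argmin_nonneg ξ p))
    (Finset.sum_nonneg fun i _ => mul_nonneg (add_nonneg (hG.lam0_nonneg ξ i)
      (mul_nonneg (hG.lam1_nonneg ξ i) (hG.argmin_nonneg ξ p i))) (hp i))

theorem Standing.hamiltonian_le_cost_zero (hG : G.Standing) (ξ : State m N) {p : Fin m → ℝ}
    (hp : ∀ i, p i ≤ 0) : G.hamiltonian ξ p ≤ G.cost ξ 0 := by
  refine (hG.hamiltonian_le ξ p (a := 0) (by simp)).trans ?_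
  have : ∑ i, (G.lam0 ξ i + G.lam1 ξ i * (0 : Ctrl m) i) * p i ≤ 0 :=
    Finset.sum_nonpos fun i _ => by
      simpa using mul_nonpos_of_nonneg_of_nonpos (hG.lam0_nonneg ξ i) (hp i)
  linarith

theorem Standing.exists_norm_argmin_le (hG : G.Standing) (M : ℝ) :
    ∃ A : ℝ, 0 ≤ A ∧ ∀ ξ p, ‖p‖ ≤ M → ‖G.argmin ξ p‖ ≤ A := by
  obtain ⟨K, hK, hLip⟩ := hG.exists_argmin_lipschitz
  refine ⟨∑ ξ, ‖G.argmin ξ 0‖ + K * |M|, by positivity, fun ξ p hp => ?_⟩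
  have h1 := hLip ξ p 0
  have h2 : ‖G.argmin ξ p‖ ≤ ‖G.argmin ξ p - G.argmin ξ 0‖ + ‖G.argmin ξ 0‖ := by
    simpa using norm_add_le (G.argmin ξ p - G.argmin ξ 0) (G.argmin ξ 0)
  have h3 : ‖G.argmin ξ 0‖ ≤ ∑ ξ, ‖G.argmin ξ 0‖ :=
    Finset.single_le_sum (f := fun ξ => ‖G.argmin ξ 0‖) (fun ξ _ => norm_nonneg _)
      (Finset.mem_univ ξ)
  have h4 : K * ‖p - 0‖ ≤ K * |M| := by
    rw [sub_zero]
    exact mul_le_mul_of_nonneg_left (hp.trans (le_abs_self M)) hK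
  linarith

/-- The Hamiltonian is an infimum of affine functions of `p`. Testing at `p` with the minimizer for
`q` bounds the difference by the rates under that minimizer, and these are bounded on bounded sets.
-/
theorem Standing.exists_hamiltonian_lipschitz (hG : G.Standing) (M : ℝ) :
    ∃ K : ℝ, 0 ≤ K ∧ ∀ ξ p q, ‖p‖ ≤ M → ‖q‖ ≤ M →
      |G.hamiltonian ξ p - G.hamiltonian ξ q| ≤ K * ‖p - q‖ := by
  obtain ⟨A, hA, hbd⟩ := hG.exists_norm_argmin_le M
  set C : ℝ := ∑ ξ, (∑ i, |G.lam0 ξ i| + (∑ i, |G.lam1 ξ i|) * A) with hC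
  have hone : ∀ ξ p q, ‖q‖ ≤ M → G.hamiltonian ξ p - G.hamiltonian ξ q ≤ C * ‖p - q‖ := by
    intro ξ p q hq
    have h1 := hG.hamiltonian_le ξ p (hG.argmin_nonneg ξ q)
    rw [hG.hamiltonian_eq ξ q]
    have h2 := (le_abs_self _).trans (abs_sum_mul_le (G.lam0 ξ) (p - q))
    have h3 := (le_abs_self _).trans (abs_sum_mul_mul_le (G.lam1 ξ) (p - q) (G.argmin ξ q))
    have h4 : ∑ i, (G.lam0 ξ i + G.lam1 ξ i * G.argmin ξ q i) * p i
        - ∑ i, (G.lam0 ξ i + G.lam1 ξ i * G.argmin ξ q i) * q i =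
        ∑ i, G.lam0 ξ i * (p - q) i + ∑ i, G.lam1 ξ i * G.argmin ξ q i * (p - q) i := by
      rw [← Finset.sum_sub_distrib, ← Finset.sum_add_distrib]
      exact Finset.sum_congr rfl fun i _ => by simp only [Pi.sub_apply]; ring
    have h5 : (∑ i, |G.lam1 ξ i|) * ‖G.argmin ξ q‖ * ‖p - q‖ ≤
        (∑ i, |G.lam1 ξ i|) * A * ‖p - q‖ := by
      have := hbd ξ q hq
      gcongr
    have h6 : (∑ i, |G.lam0 ξ i| + (∑ i, |G.lam1 ξ i|) * A) ≤ C :=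
      Finset.single_le_sum (f := fun ξ => ∑ i, |G.lam0 ξ i| + (∑ i, |G.lam1 ξ i|) * A)
        (fun ξ _ => by positivity) (Finset.mem_univ ξ)
    have h7 := mul_le_mul_of_nonneg_right h6 (norm_nonneg (p - q))
    linarith
  refine ⟨C, by positivity, fun ξ p q hp hq => abs_sub_le_iff.2 ⟨hone ξ p q hq, ?_⟩⟩
  rw [norm_sub_rev]
  exact hone ξ q p hp

/-! ### Differences, feedback controls and the generator of the other players -/

theorem diff_sub (φ ψ : State m N → ℝ) (ξ : State m N) :
    diff (φ - ψ) ξ = diff φ ξ - diff ψ ξ := by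
  funext i
  simp only [diff, Pi.sub_apply]
  ring

theorem abs_sub_le_two_mul_norm {ι : Type*} [Fintype ι] (φ : ι → ℝ) (i j : ι) :
    |φ i - φ j| ≤ 2 * ‖φ‖ := by
  have h1 : |φ i| ≤ ‖φ‖ := norm_le_pi_norm φ i
  have h2 : |φ j| ≤ ‖φ‖ := norm_le_pi_norm φ j
  linarith [abs_sub (φ i) (φ j)]

theorem norm_diff_le (φ : State m N → ℝ) (ξ : State m N) : ‖diff φ ξ‖ ≤ 2 * ‖φ‖ :=
  (pi_norm_le_iff_of_nonneg (by positivity)).2 fun _ => abs_sub_le_two_mul_norm φ _ _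

theorem Standing.feedback_nonneg (hG : G.Standing) (φ : State m N → ℝ) (ξ : State m N)
    (i : Fin m) : 0 ≤ G.feedback φ ξ i :=
  hG.argmin_nonneg ξ _ i

theorem Standing.exists_feedback_lipschitz (hG : G.Standing) :
    ∃ K : ℝ, 0 ≤ K ∧ ∀ φ ψ, ‖G.feedback φ - G.feedback ψ‖ ≤ K * ‖φ - ψ‖ := by
  obtain ⟨K, hK, hLip⟩ := hG.exists_argmin_lipschitz
  refine ⟨K * 2, by positivity, fun φ ψ => (pi_norm_le_iff_of_nonneg (by positivity)).2 fun ξ => ?_⟩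
  refine (hLip ξ _ _).trans ?_
  rw [← diff_sub, mul_assoc]
  exact mul_le_mul_of_nonneg_left (norm_diff_le _ ξ) hK

theorem Standing.exists_norm_feedback_le (hG : G.Standing) (M : ℝ) :
    ∃ A : ℝ, 0 ≤ A ∧ ∀ φ, ‖φ‖ ≤ M → ‖G.feedback φ‖ ≤ A := by
  obtain ⟨A, hA, h⟩ := hG.exists_norm_argmin_le (2 * M)
  exact ⟨A, hA, fun φ hφ => (pi_norm_le_iff_of_nonneg hA).2 fun ξ =>
    h ξ _ ((norm_diff_le φ ξ).trans (by linarith))⟩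

theorem genOthers_sub (b : State m N → Ctrl m) (φ ψ : State m N → ℝ) (ξ : State m N) :
    G.genOthers b (φ - ψ) ξ = G.genOthers b φ ξ - G.genOthers b ψ ξ := by
  simp only [genOthers, ← Finset.sum_sub_distrib, Pi.sub_apply]
  exact Finset.sum_congr rfl fun z _ => Finset.sum_congr rfl fun i _ => by ring

theorem Simplex.count_le (μ : Simplex m N) (z : Fin (m + 1)) : μ.1 z ≤ N := by
  have h : ∑ w, μ.1 w = N := (Finset.mem_piAntidiag.1 μ.2).1
  exact (Finset.single_le_sum (fun _ _ => Nat.zero_le _) (Finset.mem_univ z)).trans_eq h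

variable (G) in
/-- A common bound of all the rates. -/
noncomputable def rateBound : ℝ := ∑ ξ, ∑ i, (|G.lam0 ξ i| + |G.lam1 ξ i|)

theorem rateBound_nonneg : 0 ≤ G.rateBound := by
  unfold rateBound
  positivity

theorem add_rates_le_rateBound (ξ : State m N) (i : Fin m) :
    |G.lam0 ξ i| + |G.lam1 ξ i| ≤ G.rateBound :=
  (Finset.single_le_sum (f := fun i => |G.lam0 ξ i| + |G.lam1 ξ i|) (fun i _ => by positivity)
    (Finset.mem_univ i)).trans
  (Finset.single_le_sum (f := fun ξ => ∑ i, (|G.lam0 ξ i| + |G.lam1 ξ i|))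
    (fun ξ _ => by positivity) (Finset.mem_univ ξ))

theorem abs_sum_count_le {μ : Simplex m N} {c : Fin (m + 1) → Fin m → ℝ} {B : ℝ}
    (hc : ∀ z i, |c z i| ≤ B) :
    |∑ z, ∑ i, (μ.1 z : ℝ) * c z i| ≤ (m + 1) * m * N * B := by
  have h : ∀ z i, |(μ.1 z : ℝ) * c z i| ≤ N * B := fun z i => by
    rw [abs_mul, Nat.abs_cast]
    have h1 : (μ.1 z : ℝ) ≤ N := by exact_mod_cast Simplex.count_le μ z
    exact mul_le_mul h1 (hc z i) (abs_nonneg _) (Nat.cast_nonneg _)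
  calc |∑ z, ∑ i, (μ.1 z : ℝ) * c z i| ≤ ∑ z, ∑ i, |(μ.1 z : ℝ) * c z i| :=
        (Finset.abs_sum_le_sum_abs _ _).trans
          (Finset.sum_le_sum fun z _ => Finset.abs_sum_le_sum_abs _ _)
    _ ≤ ∑ _z : Fin (m + 1), ∑ _i : Fin m, N * B :=
        Finset.sum_le_sum fun z _ => Finset.sum_le_sum fun i _ => h z i
    _ = _ := by
        simp only [Finset.sum_const, Finset.card_univ, Fintype.card_fin, nsmul_eq_mul]
        push_cast
        ring

theorem abs_apply_le_norm (b : State m N → Ctrl m) (ξ : State m N) (i : Fin m) :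
    |b ξ i| ≤ ‖b‖ :=
  (PiLp.norm_apply_le (b ξ) i).trans (norm_le_pi_norm b ξ)

variable (G) in
theorem exists_genOthers_bound :
    ∃ C : ℝ, 0 ≤ C ∧
      (∀ b φ ξ, |G.genOthers b φ ξ| ≤ C * (1 + ‖b‖) * ‖φ‖) ∧
      ∀ b b' φ ξ, |G.genOthers b φ ξ - G.genOthers b' φ ξ| ≤ C * ‖b - b'‖ * ‖φ‖ := by
  have hR := rateBound_nonneg (G := G)
  refine ⟨(m + 1) * m * N * (G.rateBound * 2), by positivity, fun b φ ξ => ?_,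
    fun b b' φ ξ => ?_⟩
  · have := abs_sum_count_le (μ := ξ.2) (B := G.rateBound * (1 + ‖b‖) * (2 * ‖φ‖))
      (c := fun z i => (G.lam0 (z, shift ξ.2 ξ.1 z) i
        + G.lam1 (z, shift ξ.2 ξ.1 z) i * b (z, shift ξ.2 ξ.1 z) i) *
        (φ (ξ.1, shift ξ.2 (z.succAbove i) z) - φ ξ)) fun z i => by
      rw [abs_mul]
      refine mul_le_mul ?_ (abs_sub_le_two_mul_norm φ _ _) (abs_nonneg _) (by positivity)
      refine (abs_add_le _ _).trans ?_
      rw [abs_mul]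
      have h1 := add_rates_le_rateBound (G := G) (z, shift ξ.2 ξ.1 z) i
      have h2 := mul_le_mul_of_nonneg_left (abs_apply_le_norm b (z, shift ξ.2 ξ.1 z) i)
        (abs_nonneg (G.lam1 (z, shift ξ.2 ξ.1 z) i))
      have h3 := mul_le_mul_of_nonneg_right h1 (norm_nonneg b)
      have h4 := mul_nonneg (abs_nonneg (G.lam0 (z, shift ξ.2 ξ.1 z) i)) (norm_nonneg b)
      have h5 := abs_nonneg (G.lam1 (z, shift ξ.2 ξ.1 z) i)
      linarith
    refine le_of_eq_of_le ?_ (this.trans_eq (by ring))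
    simp only [genOthers, mul_assoc]
  · have := abs_sum_count_le (μ := ξ.2) (B := G.rateBound * ‖b - b'‖ * (2 * ‖φ‖))
      (c := fun z i => (G.lam1 (z, shift ξ.2 ξ.1 z) i * (b - b') (z, shift ξ.2 ξ.1 z) i) *
        (φ (ξ.1, shift ξ.2 (z.succAbove i) z) - φ ξ)) fun z i => by
      rw [abs_mul]
      refine mul_le_mul ?_ (abs_sub_le_two_mul_norm φ _ _) (abs_nonneg _) (by positivity)
      rw [abs_mul]
      refine mul_le_mul ?_ (abs_apply_le_norm (b - b') _ i) (abs_nonneg _) hR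
      linarith [add_rates_le_rateBound (G := G) (z, shift ξ.2 ξ.1 z) i,
        abs_nonneg (G.lam0 (z, shift ξ.2 ξ.1 z) i)]
    refine le_of_eq_of_le ?_ (this.trans_eq (by ring))
    simp only [genOthers, ← Finset.sum_sub_distrib]
    congr 1
    refine Finset.sum_congr rfl fun z _ => Finset.sum_congr rfl fun i _ => ?_
    simp only [Pi.sub_apply, PiLp.sub_apply]
    ring

theorem Standing.genOthers_nonneg (hG : G.Standing) {b : State m N → Ctrl m}
    (hb : ∀ ξ i, 0 ≤ b ξ i) {φ : State m N → ℝ} {ξ : State m N} (h : ∀ η, φ ξ ≤ φ η) :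
    0 ≤ G.genOthers b φ ξ :=
  Finset.sum_nonneg fun _ _ => Finset.sum_nonneg fun i _ =>
    mul_nonneg (mul_nonneg (Nat.cast_nonneg _) (add_nonneg (hG.lam0_nonneg _ i)
      (mul_nonneg (hG.lam1_nonneg _ i) (hb _ i)))) (sub_nonneg.2 (h _))

theorem Standing.genOthers_nonpos (hG : G.Standing) {b : State m N → Ctrl m}
    (hb : ∀ ξ i, 0 ≤ b ξ i) {φ : State m N → ℝ} {ξ : State m N} (h : ∀ η, φ η ≤ φ ξ) :
    G.genOthers b φ ξ ≤ 0 :=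
  Finset.sum_nonpos fun _ _ => Finset.sum_nonpos fun i _ =>
    mul_nonpos_of_nonneg_of_nonpos (mul_nonneg (Nat.cast_nonneg _) (add_nonneg (hG.lam0_nonneg _ i)
      (mul_nonneg (hG.lam1_nonneg _ i) (hb _ i)))) (sub_nonpos.2 (h _))

/-! ### The backward systems -/

variable (G) in
/-- The right-hand side `H(ξ, Δ φ) + 𝓛_μ^b φ` of the backward equations. -/
noncomputable def backwardField (b : State m N → Ctrl m) (φ : State m N → ℝ) (ξ : State m N) : ℝ :=
  G.hamiltonian ξ (diff φ ξ) + G.genOthers b φ ξ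

/-- `K` depends on `M` alone, and only one of the two controls multiplies `‖φ - ψ‖`. With the
equilibrium feedback as `b'`, the stability estimate becomes independent of the size of the other
control. -/
theorem Standing.exists_backwardField_lipschitz (hG : G.Standing) {M : ℝ} (hM : 0 ≤ M) :
    ∃ K : ℝ, 0 ≤ K ∧ ∀ b b' φ ψ ξ, ‖φ‖ ≤ M → ‖ψ‖ ≤ M →
      |G.backwardField b φ ξ - G.backwardField b' ψ ξ| ≤
        K * (1 + ‖b'‖) * ‖φ - ψ‖ + K * ‖b - b'‖ := by
  obtain ⟨K, hK, hH⟩ := hG.exists_hamiltonian_lipschitz (2 * M)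
  obtain ⟨C, hC, hO, hO'⟩ := exists_genOthers_bound G
  refine ⟨K * 2 + C + C * M, by positivity, fun b b' φ ψ ξ hφ hψ => ?_⟩
  have h1 := hH ξ (diff φ ξ) (diff ψ ξ) ((norm_diff_le φ ξ).trans (by linarith))
    ((norm_diff_le ψ ξ).trans (by linarith))
  rw [← diff_sub] at h1
  have h2 := mul_le_mul_of_nonneg_left (norm_diff_le (φ - ψ) ξ) hK
  have h3 := hO b' (φ - ψ) ξ
  rw [genOthers_sub] at h3
  have h4 := hO' b b' φ ξ
  have h5 : C * ‖b - b'‖ * ‖φ‖ ≤ C * ‖b - b'‖ * M := by gcongr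
  have h6 : G.backwardField b φ ξ - G.backwardField b' ψ ξ =
      (G.hamiltonian ξ (diff φ ξ) - G.hamiltonian ξ (diff ψ ξ))
        + (G.genOthers b φ ξ - G.genOthers b' φ ξ)
        + (G.genOthers b' φ ξ - G.genOthers b' ψ ξ) := by
    simp only [backwardField]; ring
  rw [h6]
  refine (abs_add_three _ _ _).trans ?_
  have h7 : 0 ≤ K * 2 * ‖b'‖ * ‖φ - ψ‖ := by positivity
  have h8 : 0 ≤ C * M * (1 + ‖b'‖) * ‖φ - ψ‖ := by positivity
  have h9 : 0 ≤ (K * 2 + C) * ‖b - b'‖ := by positivity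
  linarith

theorem Standing.exists_abs_backwardField_le (hG : G.Standing) (M B : ℝ) :
    ∃ C : ℝ, 0 ≤ C ∧ ∀ b φ ξ, ‖φ‖ ≤ M → ‖b‖ ≤ B → |G.backwardField b φ ξ| ≤ C := by
  obtain ⟨K, hK, hF⟩ := hG.exists_backwardField_lipschitz (abs_nonneg M)
  refine ⟨K * |M| + K * |B| + ∑ ξ, |G.backwardField 0 0 ξ|, by positivity,
    fun b φ ξ hφ hb => ?_⟩
  have hφ' := hφ.trans (le_abs_self M)
  have h1 := hF b 0 φ 0 ξ hφ' (by simp)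
  have h2 : |G.backwardField 0 0 ξ| ≤ ∑ ξ, |G.backwardField 0 0 ξ| :=
    Finset.single_le_sum (f := fun ξ => |G.backwardField 0 0 ξ|) (fun ξ _ => abs_nonneg _)
      (Finset.mem_univ ξ)
  simp only [norm_zero, sub_zero, add_zero, mul_one] at h1
  have h3 := mul_le_mul_of_nonneg_left hφ' hK
  have h4 := mul_le_mul_of_nonneg_left (hb.trans (le_abs_self B)) hK
  have h5 := abs_add_le (G.backwardField b φ ξ - G.backwardField 0 0 ξ) (G.backwardField 0 0 ξ)
  rw [sub_add_cancel] at h5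
  linarith

theorem continuous_genOthers (φ : State m N → ℝ) (ξ : State m N) :
    Continuous fun b : State m N → Ctrl m => G.genOthers b φ ξ := by
  unfold genOthers
  fun_prop

variable (G) in
/-- An a priori bound of the value functions. -/
noncomputable def valueBound : ℝ := ∑ ξ, |G.term ξ| + (∑ ξ, |G.cost ξ 0| + 1) * G.T

theorem Standing.valueBound_nonneg (hG : G.Standing) : 0 ≤ G.valueBound := by
  have := hG.T_pos.le
  unfold valueBound
  positivity

/-- Where `w` is maximal over the states, the field is at most `ℓ(ξ, 0)`; where it is minimal, the
field is nonnegative. Truncation is monotone and keeps such states extremal, so the bound involves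
neither `M` nor `b`. The extra slope `1` in `c + 1` supplies the strict inequality of the maximum
principle. -/
theorem Standing.norm_le_valueBound (hG : G.Standing) {w : ℝ → State m N → ℝ} {M : ℝ}
    {b : ℝ → State m N → Ctrl m} (hb : ∀ t ∈ Icc 0 G.T, ∀ ξ i, 0 ≤ b t ξ i)
    (hT : w G.T = G.term)
    (hw : ∀ t ∈ Icc 0 G.T, ∀ ξ, HasDerivWithinAt (fun s => w s ξ)
      (-G.backwardField (b t) (clip M (w t)) ξ) (Icc 0 G.T) t) :
    ∀ t ∈ Icc 0 G.T, ‖w t‖ ≤ G.valueBound := by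
  set c : ℝ := ∑ ξ, |G.cost ξ 0| with hc
  have hc0 : 0 ≤ c := by positivity
  have hcξ : ∀ ξ, G.cost ξ 0 ≤ c := fun ξ => (le_abs_self _).trans
    (Finset.single_le_sum (f := fun ξ => |G.cost ξ 0|) (fun ξ _ => abs_nonneg _)
      (Finset.mem_univ ξ))
  have hterm : ∀ ξ, |G.term ξ| ≤ ∑ ξ, |G.term ξ| := fun ξ =>
    Finset.single_le_sum (f := fun ξ => |G.term ξ|) (fun ξ _ => abs_nonneg _) (Finset.mem_univ ξ)
  have hlin : ∀ t, HasDerivAt (fun s => (c + 1) * (G.T - s)) (-(c + 1)) t := fun t => by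
    simpa using ((hasDerivAt_id' t).const_sub G.T).const_mul (c + 1)
  have hup := le_of_deriv_pos_of_isMax (f := fun ξ t => w t ξ - (c + 1) * (G.T - t))
    (f' := fun ξ t => -G.backwardField (b t) (clip M (w t)) ξ - -(c + 1)) (a := 0) (b := G.T)
    (C := ∑ ξ, |G.term ξ|) (fun ξ t ht => (hw t ht ξ).sub (hlin t).hasDerivWithinAt)
    (fun ξ => by simpa [hT] using (le_abs_self _).trans (hterm ξ)) ?_
  · have hlow := le_of_deriv_pos_of_isMax (f := fun ξ t => -w t ξ - (c + 1) * (G.T - t))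
      (f' := fun ξ t => - -G.backwardField (b t) (clip M (w t)) ξ - -(c + 1)) (a := 0) (b := G.T)
      (C := ∑ ξ, |G.term ξ|) (fun ξ t ht => (hw t ht ξ).fun_neg.sub (hlin t).hasDerivWithinAt)
      (fun ξ => by simpa [hT] using (neg_le_abs _).trans (hterm ξ)) ?_
    · intro t ht
      refine (pi_norm_le_iff_of_nonneg hG.valueBound_nonneg).2 fun ξ => ?_
      have h1 := hup t ht ξ
      have h2 := hlow t ht ξ
      have h3 : (c + 1) * (G.T - t) ≤ (c + 1) * G.T :=
        mul_le_mul_of_nonneg_left (by linarith [ht.1]) (by positivity)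
      rw [Real.norm_eq_abs, abs_le]
      unfold valueBound
      constructor <;> linarith
    · intro t ht ξ hmax _
      have hle : ∀ η, clip M (w t) ξ ≤ clip M (w t) η := fun η =>
        clip_mono M (by linarith [hmax η])
      have h1 := hG.hamiltonian_nonneg ξ (p := diff (clip M (w t)) ξ) fun i =>
        sub_nonneg.2 (hle _)
      have h2 := hG.genOthers_nonneg (hb t (Ico_subset_Icc_self ht)) hle
      unfold backwardField
      linarith
  · intro t ht ξ hmax _
    have hle : ∀ η, clip M (w t) η ≤ clip M (w t) ξ := fun η =>
      clip_mono M (by linarith [hmax η])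
    have h1 := hG.hamiltonian_le_cost_zero ξ (p := diff (clip M (w t)) ξ) fun i =>
      sub_nonpos.2 (hle _)
    have h2 := hG.genOthers_nonpos (hb t (Ico_subset_Icc_self ht)) hle
    have h3 := hcξ ξ
    unfold backwardField
    linarith

/-- Existence for the backward system whose control `b t φ` may depend on the solution. -/
theorem Standing.exists_backward_solution (hG : G.Standing)
    {b : ℝ → (State m N → ℝ) → State m N → Ctrl m}
    (hb0 : ∀ t ∈ Icc 0 G.T, ∀ φ ξ i, 0 ≤ b t φ ξ i)
    (hbc : ∀ φ, ContinuousOn (fun t => b t φ) (Icc 0 G.T)) {L : ℝ} (hL : 0 ≤ L)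
    (hbL : ∀ t φ ψ, ‖b t φ - b t ψ‖ ≤ L * ‖φ - ψ‖) :
    ∃ w : ℝ → State m N → ℝ, w G.T = G.term ∧
      (∀ t ∈ Icc 0 G.T, ∀ ξ, HasDerivWithinAt (fun s => w s ξ)
        (-G.backwardField (b t (w t)) (w t) ξ) (Icc 0 G.T) t) ∧
      ∀ t ∈ Icc 0 G.T, ‖w t‖ ≤ G.valueBound := by
  set M := G.valueBound with hM
  have hM0 : 0 ≤ M := hG.valueBound_nonneg
  obtain ⟨K, hK, hF⟩ := hG.exists_backwardField_lipschitz hM0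
  obtain ⟨B, hB⟩ := isCompact_Icc.exists_bound_of_continuousOn (hbc 0)
  have hT := hG.T_pos.le
  have hB0 : 0 ≤ B := (norm_nonneg _).trans (hB 0 ⟨le_rfl, hT⟩)
  have hbound : ∀ t ∈ Icc 0 G.T, ∀ φ, ‖φ‖ ≤ M → ‖b t φ‖ ≤ B + L * M := by
    intro t ht φ hφ
    have h1 := hbL t φ 0
    have h2 := norm_add_le (b t φ - b t 0) (b t 0)
    rw [sub_add_cancel] at h2
    rw [sub_zero] at h1
    linarith [hB t ht, mul_le_mul_of_nonneg_left hφ hL]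
  have key := exists_solution_clip (F := fun t φ ξ => -G.backwardField (b t φ) φ ξ)
    (a := 0) (b := G.T) (t₀ := G.T) (M := M) (K := K * (1 + (B + L * M)) + K * L) ⟨hT, le_rfl⟩ hM0
    (by positivity) G.term ?_ ?_
  · obtain ⟨w, hwT, hw⟩ := key
    have hw' : ∀ t ∈ Icc 0 G.T, ∀ ξ, HasDerivWithinAt (fun s => w s ξ)
        (-G.backwardField (b t (clip M (w t))) (clip M (w t)) ξ) (Icc 0 G.T) t :=
      fun t ht ξ => hasDerivWithinAt_pi.1 (hw t ht) ξ
    -- The truncation level is the a priori bound itself, so the truncation is never active.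
    have hle := hG.norm_le_valueBound (b := fun t => b t (clip M (w t)))
      (fun t ht => hb0 t ht _) hwT hw'
    refine ⟨w, hwT, fun t ht ξ => ?_, hle⟩
    have := hw' t ht ξ
    rwa [clip_eq_self (hle t ht)] at this
  · intro t ht φ ψ hφ hψ
    refine (pi_norm_le_iff_of_nonneg (by positivity)).2 fun ξ => ?_
    rw [Pi.sub_apply, ← neg_sub', norm_neg, Real.norm_eq_abs]
    refine (hF _ (b t ψ) _ _ ξ hφ hψ).trans ?_
    have h1 := hbound t ht ψ hψ
    have h2 := mul_le_mul_of_nonneg_left (hbL t φ ψ) hK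
    have h3 : K * (1 + ‖b t ψ‖) * ‖φ - ψ‖ ≤ K * (1 + (B + L * M)) * ‖φ - ψ‖ := by gcongr
    linarith
  · intro φ _
    refine continuousOn_pi.2 fun ξ => ?_
    exact (continuousOn_const.add ((continuous_genOthers φ ξ).comp_continuousOn (hbc φ))).neg

theorem Standing.exists_isNLLSolution (hG : G.Standing) :
    ∃ v : ℝ → State m N → ℝ, G.IsNLLSolution v ∧ ∀ t ∈ Icc 0 G.T, ‖v t‖ ≤ G.valueBound := by
  obtain ⟨L, hL, hfb⟩ := hG.exists_feedback_lipschitz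
  obtain ⟨v, hvT, hv, hle⟩ := hG.exists_backward_solution (b := fun _ φ => G.feedback φ)
    (fun _ _ => hG.feedback_nonneg) (fun _ => continuousOn_const) hL (fun _ => hfb)
  exact ⟨v, ⟨fun ξ => congrFun hvT ξ, hv⟩, hle⟩

theorem IsAdmissible.continuousOn {α : ℝ → State m N → Ctrl m} (hα : G.IsAdmissible α) :
    ContinuousOn α (Icc 0 G.T) := by
  obtain ⟨⟨K, hK⟩, -⟩ := hα
  exact continuousOn_pi.2 fun ξ => (hK ξ).continuousOn

theorem Standing.exists_hjb_solution (hG : G.Standing) {β : ℝ → State m N → Ctrl m}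
    (hβ : G.IsAdmissible β) :
    ∃ w : ℝ → State m N → ℝ, w G.T = G.term ∧
      (∀ t ∈ Icc 0 G.T, ∀ ξ, HasDerivWithinAt (fun s => w s ξ)
        (-G.backwardField (β t) (w t) ξ) (Icc 0 G.T) t) ∧
      ∀ t ∈ Icc 0 G.T, ‖w t‖ ≤ G.valueBound :=
  hG.exists_backward_solution (b := fun t _ => β t) (fun t ht _ => hβ.2 t ht)
    (fun _ => hβ.continuousOn) le_rfl (by simp)

/-- The feedback control of a solution of a backward system is admissible. -/
theorem Standing.isAdmissible_feedback (hG : G.Standing) {w : ℝ → State m N → ℝ}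
    {w' : ℝ → State m N → ℝ} {C : ℝ} (hC : 0 ≤ C)
    (hw : ∀ t ∈ Icc 0 G.T, ∀ ξ, HasDerivWithinAt (fun s => w s ξ) (w' t ξ) (Icc 0 G.T) t)
    (hw' : ∀ t ∈ Icc 0 G.T, ∀ ξ, |w' t ξ| ≤ C) :
    G.IsAdmissible fun t => G.feedback (w t) := by
  obtain ⟨L, hL, hfb⟩ := hG.exists_feedback_lipschitz
  refine ⟨⟨NNReal.mk (L * C) (by positivity), fun ξ => LipschitzOnWith.of_dist_le_mul fun s hs t ht => ?_⟩,
    fun t _ => hG.feedback_nonneg _⟩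
  rw [dist_eq_norm]
  calc ‖G.feedback (w s) ξ - G.feedback (w t) ξ‖
      ≤ ‖G.feedback (w s) - G.feedback (w t)‖ :=
        norm_le_pi_norm (G.feedback (w s) - G.feedback (w t)) ξ
    _ ≤ L * ‖w s - w t‖ := hfb _ _
    _ ≤ L * (C * dist s t) := by
        refine mul_le_mul_of_nonneg_left ?_ hL
        refine (pi_norm_le_iff_of_nonneg (by positivity)).2 fun η => ?_
        rw [dist_eq_norm]
        exact (convex_Icc 0 G.T).norm_image_sub_le_of_norm_hasDerivWithin_le
          (f := fun s => w s η) (fun t ht => hw t ht η) (fun t ht => hw' t ht η) ht hs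
    _ = _ := (mul_assoc _ _ _).symm

/-! ### The law of the controlled chain -/

variable (G) in
/-- The full generator, as a linear functional of the test function. -/
noncomputable def generator (a b : State m N → Ctrl m) (ξ : State m N) :
    (State m N → ℝ) →ₗ[ℝ] ℝ where
  toFun φ := G.genTagged a φ ξ + G.genOthers b φ ξ
  map_add' φ ψ := by
    have h1 : G.genTagged a (φ + ψ) ξ = G.genTagged a φ ξ + G.genTagged a ψ ξ := by
      simp only [genTagged, ← Finset.sum_add_distrib, Pi.add_apply]
      exact Finset.sum_congr rfl fun i _ => by ring
    have h2 : G.genOthers b (φ + ψ) ξ = G.genOthers b φ ξ + G.genOthers b ψ ξ := by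
      simp only [genOthers, ← Finset.sum_add_distrib, Pi.add_apply]
      exact Finset.sum_congr rfl fun z _ => Finset.sum_congr rfl fun i _ => by ring
    rw [h1, h2]
    ring
  map_smul' c φ := by
    simp only [genTagged, genOthers, Pi.smul_apply, smul_eq_mul, RingHom.id_apply, mul_add,
      Finset.mul_sum]
    congr 1
    · exact Finset.sum_congr rfl fun i _ => by ring
    · exact Finset.sum_congr rfl fun z _ => Finset.sum_congr rfl fun i _ => by ring

variable (G) in
/-- The jump rate from `ξ` to `η`. -/
noncomputable def rate (a b : State m N → Ctrl m) (ξ η : State m N) : ℝ :=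
  G.genTagged a (Pi.single η 1) ξ + G.genOthers b (Pi.single η 1) ξ

/-- Expanding `φ` in indicators passes from the forward equation, stated on indicators, to arbitrary
test functions. -/
theorem sum_mul_rate (a b : State m N → Ctrl m) (φ : State m N → ℝ) (ξ : State m N) :
    ∑ η, φ η * G.rate a b ξ η = G.genTagged a φ ξ + G.genOthers b φ ξ := by
  change ∑ η, φ η * G.generator a b ξ (Pi.single η 1) = G.generator a b ξ φ
  have h : φ = ∑ η, φ η • (Pi.single η 1 : State m N → ℝ) := by
    funext ζ
    simp [Finset.sum_apply, Pi.single_apply]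
  conv_rhs => rw [h, map_sum]
  exact Finset.sum_congr rfl fun η _ => by rw [map_smul, smul_eq_mul]

theorem sum_rate (a b : State m N → Ctrl m) (ξ : State m N) : ∑ η, G.rate a b ξ η = 0 := by
  have h := sum_mul_rate (G := G) a b (fun _ => 1) ξ
  simp only [one_mul] at h
  rw [h]
  simp [genTagged, genOthers]

theorem single_one_nonneg (η ζ : State m N) : 0 ≤ (Pi.single η 1 : State m N → ℝ) ζ := by
  rw [Pi.single_apply]
  split_ifs <;> norm_num

theorem Standing.rate_nonneg (hG : G.Standing) {a b : State m N → Ctrl m}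
    (ha : ∀ ξ i, 0 ≤ a ξ i) (hb : ∀ ξ i, 0 ≤ b ξ i) {ξ η : State m N} (h : ξ ≠ η) :
    0 ≤ G.rate a b ξ η := by
  have hmin : ∀ ζ, (Pi.single η 1 : State m N → ℝ) ξ ≤ (Pi.single η 1 : State m N → ℝ) ζ := by
    intro ζ
    rw [Pi.single_eq_of_ne h]
    exact single_one_nonneg η ζ
  refine add_nonneg (Finset.sum_nonneg fun i _ => mul_nonneg (add_nonneg (hG.lam0_nonneg _ i)
    (mul_nonneg (hG.lam1_nonneg _ i) (ha _ i))) (sub_nonneg.2 (hmin _))) ?_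
  exact hG.genOthers_nonneg hb hmin

theorem continuousOn_rate {α β : ℝ → State m N → Ctrl m} {s : Set ℝ} (hα : ContinuousOn α s)
    (hβ : ContinuousOn β s) : ContinuousOn (fun u ξ η => G.rate (α u) (β u) ξ η) s := by
  refine continuousOn_pi.2 fun ξ => continuousOn_pi.2 fun η => ?_
  refine ContinuousOn.add ?_ ((continuous_genOthers _ ξ).comp_continuousOn hβ)
  have h : Continuous fun a : State m N → Ctrl m =>
      G.genTagged a (Pi.single η 1 : State m N → ℝ) ξ := by
    unfold genTagged
    fun_prop
  exact h.comp_continuousOn hα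

theorem exists_abs_rate_le {α β : ℝ → State m N → Ctrl m} {t T : ℝ}
    (hα : ContinuousOn α (Icc t T)) (hβ : ContinuousOn β (Icc t T)) :
    ∃ C : ℝ, 0 ≤ C ∧ ∀ u ∈ Icc t T, ∀ ξ η, |G.rate (α u) (β u) ξ η| ≤ C := by
  obtain ⟨C, hC⟩ := isCompact_Icc.exists_bound_of_continuousOn (continuousOn_rate (G := G) hα hβ)
  refine ⟨|C|, abs_nonneg C, fun u hu ξ η => ?_⟩
  exact (norm_le_pi_norm (fun η => G.rate (α u) (β u) ξ η) η).trans
    ((norm_le_pi_norm (fun ξ η => G.rate (α u) (β u) ξ η) ξ).trans ((hC u hu).trans (le_abs_self C)))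

theorem abs_sum_mul_le_card {ι : Type*} [Fintype ι] {r x : ι → ℝ} {C : ℝ}
    (hr : ∀ i, |r i| ≤ C) : |∑ i, x i * r i| ≤ Fintype.card ι * C * ‖x‖ := by
  simp only [mul_comm (x _)]
  refine (abs_sum_mul_le r x).trans (mul_le_mul_of_nonneg_right ?_ (norm_nonneg x))
  refine (Finset.sum_le_sum fun i _ => hr i).trans_eq ?_
  simp

/-- Existence for the forward equation, with a nonnegative solution. -/
theorem Standing.exists_isChainLaw (hG : G.Standing) {α β : ℝ → State m N → Ctrl m}
    (hα : G.IsAdmissible α) (hβ : G.IsAdmissible β) {t : ℝ} (ht : t ∈ Icc 0 G.T)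
    (ξ₀ : State m N) :
    ∃ p, G.IsChainLaw α β t ξ₀ p ∧ ∀ u ∈ Icc t G.T, ∀ η, 0 ≤ p u η := by
  have hsub : Icc t G.T ⊆ Icc 0 G.T := Icc_subset_Icc_left ht.1
  have hαc := hα.continuousOn.mono hsub
  have hβc := hβ.continuousOn.mono hsub
  obtain ⟨C, hC, hbd⟩ := exists_abs_rate_le (G := G) hαc hβc
  have key := exists_solution_clip
    -- The positive part enforces nonnegativity: where `p η < 0` the diagonal term vanishes and all
    -- the others are nonnegative. Total mass one then gives `p η ≤ 1`, so neither modification is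
    -- active.
    (F := fun u x η => ∑ ξ, max 0 (x ξ) * G.rate (α u) (β u) ξ η)
    (a := t) (b := G.T) (t₀ := t) (M := 1) (K := Fintype.card (State m N) * C)
    ⟨le_rfl, ht.2⟩ zero_le_one (by positivity) (Pi.single ξ₀ 1) ?_ ?_
  · obtain ⟨p, hp0, hp⟩ := key
    have hp' : ∀ u ∈ Icc t G.T, ∀ η, HasDerivWithinAt (fun s => p s η)
        (∑ ξ, max 0 (clip 1 (p u) ξ) * G.rate (α u) (β u) ξ η) (Icc t G.T) u :=
      fun u hu η => hasDerivWithinAt_pi.1 (hp u hu) η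
    have hnonneg : ∀ u ∈ Icc t G.T, ∀ η, 0 ≤ p u η := by
      intro u hu η
      refine nonneg_of_deriv_nonneg_of_neg (f := fun s => p s η) (fun u hu => hp' u hu η) ?_
        (fun u hu hneg => ?_) u hu
      · simp only [hp0]
        exact single_one_nonneg ξ₀ η
      · refine Finset.sum_nonneg fun ξ _ => ?_
        rcases eq_or_ne ξ η with rfl | hne
        · have h1 : clip 1 (p u) ξ ≤ 0 :=
            max_le (by norm_num) ((min_le_right _ _).trans hneg.le)
          rw [max_eq_left h1, zero_mul]
        · exact mul_nonneg (le_max_left _ _)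
            (hG.rate_nonneg (hα.2 u (hsub hu)) (hβ.2 u (hsub hu)) hne)
    have hsum : ∀ u ∈ Icc t G.T, ∑ η, p u η = 1 := by
      have hder : ∀ u ∈ Icc t G.T,
          HasDerivWithinAt (fun s => ∑ η, p s η) 0 (Icc t G.T) u := by
        intro u hu
        have h1 := HasDerivWithinAt.fun_sum (u := Finset.univ) fun η _ => hp' u hu η
        rw [Finset.sum_comm] at h1
        simpa only [← Finset.mul_sum, sum_rate, mul_zero, Finset.sum_const_zero] using h1
      intro u hu
      rw [constant_of_has_deriv_right_zero (fun u hu => (hder u hu).continuousWithinAt)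
        (fun u hu => (hder u (Ico_subset_Icc_self hu)).Ici_of_Icc hu) u hu]
      simp [hp0]
    have hclip : ∀ u ∈ Icc t G.T, ∀ ξ, max 0 (clip 1 (p u) ξ) = p u ξ := by
      intro u hu ξ
      have h1 : p u ξ ≤ 1 := by
        rw [← hsum u hu]
        exact Finset.single_le_sum (fun η _ => hnonneg u hu η) (Finset.mem_univ ξ)
      have h2 := hnonneg u hu ξ
      have h3 : -1 ≤ p u ξ := by linarith
      simp [clip, h1, h2, h3]
    refine ⟨p, ⟨hp0, fun u hu η => ?_⟩, hnonneg⟩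
    have := hp' u hu η
    simp only [hclip u hu] at this
    exact this
  · intro u hu x y _ _
    refine (pi_norm_le_iff_of_nonneg (by positivity)).2 fun η => ?_
    have h1 := abs_sum_mul_le_card (x := fun ξ => max 0 (x ξ) - max 0 (y ξ))
      (r := fun ξ => G.rate (α u) (β u) ξ η) fun ξ => hbd u hu ξ η
    simp only [sub_mul, Finset.sum_sub_distrib] at h1
    refine h1.trans (mul_le_mul_of_nonneg_left ?_ (by positivity))
    refine (pi_norm_le_iff_of_nonneg (norm_nonneg _)).2 fun ξ => ?_
    refine le_trans ?_ (norm_le_pi_norm (x - y) ξ)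
    refine (abs_max_sub_max_le_max _ _ _ _).trans ?_
    simp
  · intro x _
    refine continuousOn_pi.2 fun η => continuousOn_finsetSum _ fun ξ _ => ?_
    exact continuousOn_const.mul
      (continuousOn_pi.1 (continuousOn_pi.1 (continuousOn_rate hαc hβc) ξ) η)

/-- The forward equation is linear with bounded coefficients. Uniqueness is what transfers
nonnegativity from the constructed solution to the one selected by `chainLaw`. -/
theorem IsChainLaw.eqOn {α β : ℝ → State m N → Ctrl m}
    (hα : G.IsAdmissible α) (hβ : G.IsAdmissible β) {t : ℝ} (ht : t ∈ Icc 0 G.T)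
    {ξ₀ : State m N} {p q : ℝ → State m N → ℝ} (hp : G.IsChainLaw α β t ξ₀ p)
    (hq : G.IsChainLaw α β t ξ₀ q) : EqOn p q (Icc t G.T) := by
  have hsub : Icc t G.T ⊆ Icc 0 G.T := Icc_subset_Icc_left ht.1
  obtain ⟨C, hC, hbd⟩ := exists_abs_rate_le (G := G) (hα.continuousOn.mono hsub)
    (hβ.continuousOn.mono hsub)
  have hder : ∀ {r}, G.IsChainLaw α β t ξ₀ r → ∀ u ∈ Icc t G.T,
      HasDerivWithinAt r (fun η => ∑ ξ, r u ξ * G.rate (α u) (β u) ξ η) (Icc t G.T) u :=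
    fun hr u hu => hasDerivWithinAt_pi.2 fun η => hr.2 u hu η
  refine ODE_solution_unique_of_mem_Icc_right (s := fun _ => univ)
    (v := fun u x η => ∑ ξ, x ξ * G.rate (α u) (β u) ξ η)
    (K := NNReal.mk (Fintype.card (State m N) * C) (by positivity)) (fun u hu => ?_)
    (fun u hu => (hder hp u hu).continuousWithinAt)
    (fun u hu => (hder hp u (Ico_subset_Icc_self hu)).Ici_of_Icc hu) (fun _ _ => mem_univ _)
    (fun u hu => (hder hq u hu).continuousWithinAt)
    (fun u hu => (hder hq u (Ico_subset_Icc_self hu)).Ici_of_Icc hu) (fun _ _ => mem_univ _)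
    (hp.1.trans hq.1.symm)
  refine LipschitzOnWith.of_dist_le_mul fun x _ y _ => ?_
  rw [dist_eq_norm, dist_eq_norm, NNReal.coe_mk]
  refine (pi_norm_le_iff_of_nonneg (by positivity)).2 fun η => ?_
  have h1 := abs_sum_mul_le_card (x := x - y) (r := fun ξ => G.rate (α u) (β u) ξ η)
    fun ξ => hbd u (Ico_subset_Icc_self hu) ξ η
  simpa only [Pi.sub_apply, sub_mul, Finset.sum_sub_distrib, Real.norm_eq_abs] using h1

theorem Standing.isChainLaw_chainLaw (hG : G.Standing) {α β : ℝ → State m N → Ctrl m}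
    (hα : G.IsAdmissible α) (hβ : G.IsAdmissible β) {t : ℝ} (ht : t ∈ Icc 0 G.T)
    (ξ₀ : State m N) : G.IsChainLaw α β t ξ₀ (G.chainLaw α β t ξ₀) :=
  Classical.epsilon_spec ((hG.exists_isChainLaw hα hβ ht ξ₀).imp fun _ => And.left)

theorem Standing.chainLaw_nonneg (hG : G.Standing) {α β : ℝ → State m N → Ctrl m}
    (hα : G.IsAdmissible α) (hβ : G.IsAdmissible β) {t : ℝ} (ht : t ∈ Icc 0 G.T)
    (ξ₀ : State m N) {u : ℝ} (hu : u ∈ Icc t G.T) (η : State m N) :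
    0 ≤ G.chainLaw α β t ξ₀ u η := by
  obtain ⟨p, hp, hp0⟩ := hG.exists_isChainLaw hα hβ ht ξ₀
  rw [(hG.isChainLaw_chainLaw hα hβ ht ξ₀).eqOn hα hβ ht hp hu]
  exact hp0 u hu η

/-! ### Verification -/

/-- Dynkin's formula along a solution of the backward equation. -/
theorem IsChainLaw.hasDerivWithinAt_sum_mul {α β : ℝ → State m N → Ctrl m} {t : ℝ}
    (ht : t ∈ Icc 0 G.T) {ξ₀ : State m N} {p : ℝ → State m N → ℝ}
    (hp : G.IsChainLaw α β t ξ₀ p) {w : ℝ → State m N → ℝ}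
    (hw : ∀ t ∈ Icc 0 G.T, ∀ ξ, HasDerivWithinAt (fun s => w s ξ)
      (-G.backwardField (β t) (w t) ξ) (Icc 0 G.T) t) {u : ℝ} (hu : u ∈ Icc t G.T) :
    HasDerivWithinAt (fun s => ∑ ξ, p s ξ * w s ξ)
      (∑ ξ, p u ξ * (G.genTagged (α u) (w u) ξ - G.hamiltonian ξ (diff (w u) ξ)))
      (Icc t G.T) u := by
  have hsub : Icc t G.T ⊆ Icc 0 G.T := Icc_subset_Icc_left ht.1
  have h1 := HasDerivWithinAt.fun_sum (u := Finset.univ) fun η _ =>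
    (hp.2 u hu η).mul ((hw u (hsub hu) η).mono hsub)
  refine h1.congr_deriv ?_
  rw [Finset.sum_add_distrib]
  -- Exchanging the sums moves the generator from the law to `w`; its `genOthers` part then cancels
  -- against the backward equation.
  have h2 : ∑ η, (∑ ξ, p u ξ * G.rate (α u) (β u) ξ η) * w u η =
      ∑ ξ, p u ξ * (G.genTagged (α u) (w u) ξ + G.genOthers (β u) (w u) ξ) := by
    simp only [Finset.sum_mul]
    rw [Finset.sum_comm]
    refine Finset.sum_congr rfl fun ξ _ => ?_
    rw [← sum_mul_rate, Finset.mul_sum]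
    exact Finset.sum_congr rfl fun η _ => by ring
  refine (congrArg₂ (· + ·) h2 rfl).trans ?_
  rw [← Finset.sum_add_distrib]
  refine Finset.sum_congr rfl fun ξ _ => ?_
  simp only [backwardField]
  ring

theorem Standing.continuousOn_running_cost (hG : G.Standing) {α β : ℝ → State m N → Ctrl m}
    (hα : G.IsAdmissible α) {t : ℝ} (ht : t ∈ Icc 0 G.T) {ξ₀ : State m N}
    {p : ℝ → State m N → ℝ} (hp : G.IsChainLaw α β t ξ₀ p) :
    ContinuousOn (fun u => ∑ η, p u η * G.cost η (α u η)) (Icc t G.T) := by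
  have hsub : Icc t G.T ⊆ Icc 0 G.T := Icc_subset_Icc_left ht.1
  refine continuousOn_finsetSum _ fun η _ => ContinuousOn.mul
    (fun u hu => (hp.2 u hu η).continuousWithinAt) ?_
  exact (hG.cost_continuous η).comp
    (continuousOn_pi.1 (hα.continuousOn.mono hsub) η) fun u hu => hα.2 u (hsub hu) η

/-- Any control gives an objective above the Hamiltonian, so the mean of `w` along the chain
decreases no faster than running cost accrues. Nonnegativity of the law is essential here. -/
theorem Standing.le_payoff (hG : G.Standing) {α β : ℝ → State m N → Ctrl m}
    (hα : G.IsAdmissible α) (hβ : G.IsAdmissible β) {w : ℝ → State m N → ℝ}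
    (hT : w G.T = G.term)
    (hw : ∀ t ∈ Icc 0 G.T, ∀ ξ, HasDerivWithinAt (fun s => w s ξ)
      (-G.backwardField (β t) (w t) ξ) (Icc 0 G.T) t) {t : ℝ} (ht : t ∈ Icc 0 G.T)
    (ξ : State m N) : w t ξ ≤ G.payoff t ξ α β := by
  have hsub : Icc t G.T ⊆ Icc 0 G.T := Icc_subset_Icc_left ht.1
  have hp := hG.isChainLaw_chainLaw hα hβ ht ξ
  have hp0 := fun u hu η => hG.chainLaw_nonneg hα hβ ht ξ (u := u) hu η
  unfold payoff
  set p := G.chainLaw α β t ξ with hp_def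
  have hd := fun u hu => hp.hasDerivWithinAt_sum_mul ht hw (u := u) hu
  have h := intervalIntegral.integral_le_sub_of_hasDeriv_right_of_le ht.2
    (fun u hu => (hd u hu).continuousWithinAt)
    (fun u hu => ((hd u (Ioo_subset_Icc_self hu)).Ici_of_Icc (Ioo_subset_Ico_self hu)).mono
      Ioi_subset_Ici_self)
    ((hG.continuousOn_running_cost hα ht hp).neg.integrableOn_Icc) fun u hu => ?_
  · simp only [hT, hp.1] at h
    have h3 : ∑ η, (Pi.single ξ 1 : State m N → ℝ) η * w t η = w t ξ := by
      simp [Pi.single_apply]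
    rw [h3] at h
    have h4 : ∫ u in t..G.T, (-fun u => ∑ η, p u η * G.cost η (α u η)) u =
        -∫ u in t..G.T, ∑ η, p u η * G.cost η (α u η) := by
      simp only [Pi.neg_apply, intervalIntegral.integral_neg]
    linarith
  · have hu' := Ioo_subset_Icc_self hu
    simp only [Pi.neg_apply]
    rw [← Finset.sum_neg_distrib]
    refine Finset.sum_le_sum fun η _ => ?_
    rw [← mul_neg]
    refine mul_le_mul_of_nonneg_left ?_ (hp0 u hu' η)
    have := hG.hamiltonian_le η (diff (w u) η) (hα.2 u (hsub hu') η)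
    unfold genTagged
    unfold diff at this ⊢
    linarith

/-- The feedback attains the Hamiltonian, so the inequality behind `le_payoff` becomes an equality.
-/
theorem Standing.payoff_feedback (hG : G.Standing) {β : ℝ → State m N → Ctrl m}
    (hβ : G.IsAdmissible β) {w : ℝ → State m N → ℝ}
    (hα : G.IsAdmissible fun t => G.feedback (w t)) (hT : w G.T = G.term)
    (hw : ∀ t ∈ Icc 0 G.T, ∀ ξ, HasDerivWithinAt (fun s => w s ξ)
      (-G.backwardField (β t) (w t) ξ) (Icc 0 G.T) t) {t : ℝ} (ht : t ∈ Icc 0 G.T)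
    (ξ : State m N) : G.payoff t ξ (fun t => G.feedback (w t)) β = w t ξ := by
  have hp := hG.isChainLaw_chainLaw hα hβ ht ξ
  unfold payoff
  set p := G.chainLaw (fun t => G.feedback (w t)) β t ξ with hp_def
  have hd : ∀ u ∈ Icc t G.T, HasDerivWithinAt (fun s => ∑ ξ, p s ξ * w s ξ)
      (-∑ η, p u η * G.cost η (G.feedback (w u) η)) (Icc t G.T) u := by
    intro u hu
    refine (hp.hasDerivWithinAt_sum_mul ht hw hu).congr_deriv ?_
    rw [← Finset.sum_neg_distrib]
    refine Finset.sum_congr rfl fun η _ => ?_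
    rw [hG.hamiltonian_eq, ← mul_neg]
    simp only [genTagged, feedback, diff]
    ring
  have h := intervalIntegral.integral_eq_sub_of_hasDeriv_right_of_le_real ht.2
    (fun u hu => (hd u hu).continuousWithinAt)
    (fun u hu => ((hd u (Ioo_subset_Icc_self hu)).Ici_of_Icc (Ioo_subset_Ico_self hu)).mono
      Ioi_subset_Ici_self)
    ((hG.continuousOn_running_cost hα ht hp).neg.integrableOn_Icc)
  simp only [hT, hp.1, intervalIntegral.integral_neg] at h
  have h3 : ∑ η, (Pi.single ξ 1 : State m N → ℝ) η * w t η = w t ξ := by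
    simp [Pi.single_apply]
  rw [h3] at h
  linarith

/-- The value function is the classical solution of the Hamilton-Jacobi-Bellman equation. -/
theorem Standing.value_spec (hG : G.Standing) {β : ℝ → State m N → Ctrl m}
    (hβ : G.IsAdmissible β) :
    G.value β G.T = G.term ∧
      (∀ t ∈ Icc 0 G.T, ∀ ξ, HasDerivWithinAt (fun s => G.value β s ξ)
        (-G.backwardField (β t) (G.value β t) ξ) (Icc 0 G.T) t) ∧
      (∀ t ∈ Icc 0 G.T, ‖G.value β t‖ ≤ G.valueBound) ∧
      G.IsAdmissible (G.bestResponse β) := by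
  obtain ⟨w, hT, hw, hbd⟩ := hG.exists_hjb_solution hβ
  obtain ⟨B, hB⟩ := isCompact_Icc.exists_bound_of_continuousOn hβ.continuousOn
  obtain ⟨C, hC, hfield⟩ := hG.exists_abs_backwardField_le G.valueBound B
  have hadm := hG.isAdmissible_feedback hC hw fun t ht ξ => by
    rw [abs_neg]
    exact hfield _ _ ξ (hbd t ht) (hB t ht)
  have hval : ∀ t ∈ Icc 0 G.T, G.value β t = w t := by
    intro t ht
    funext ξ
    have : Nonempty {α : ℝ → State m N → Ctrl m // G.IsAdmissible α} := ⟨⟨_, hadm⟩⟩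
    have hle : ∀ α : {α : ℝ → State m N → Ctrl m // G.IsAdmissible α},
        w t ξ ≤ G.payoff t ξ α.1 β := fun α => hG.le_payoff α.2 hβ hT hw ht ξ
    refine le_antisymm ?_ (le_ciInf hle)
    exact (ciInf_le ⟨w t ξ, forall_mem_range.2 hle⟩ ⟨_, hadm⟩).trans_eq
      (hG.payoff_feedback hβ hadm hT hw ht ξ)
  have hfb : ∀ t ∈ Icc 0 G.T, G.bestResponse β t = G.feedback (w t) := fun t ht => by
    rw [bestResponse, hval t ht]
  refine ⟨(hval G.T ⟨hG.T_pos.le, le_rfl⟩).trans hT, fun t ht ξ => ?_, fun t ht => ?_, ?_, ?_⟩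
  · rw [hval t ht]
    exact (hw t ht ξ).congr (fun s hs => by rw [hval s hs]) (by rw [hval t ht])
  · rw [hval t ht]
    exact hbd t ht
  · obtain ⟨K, hK⟩ := hadm.1
    exact ⟨K, fun ξ s hs t ht => by simpa only [hfb s hs, hfb t ht] using hK ξ hs ht⟩
  · intro t ht
    rw [hfb t ht]
    exact hadm.2 t ht

/-! ### Uniqueness and convergence of the iteration -/

/-- Both solutions are continuous, hence bounded on `[0,T]`, and the coupled field is Lipschitz on
bounded sets; the backward Gronwall inequality with `E = 0` gives equality. -/
theorem Standing.isNLLSolution_unique (hG : G.Standing) {v w : ℝ → State m N → ℝ}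
    (hv : G.IsNLLSolution v) (hw : G.IsNLLSolution w) : ∀ t ∈ Icc 0 G.T, w t = v t := by
  have hcont : ∀ {u}, G.IsNLLSolution u → ContinuousOn u (Icc 0 G.T) := fun hu =>
    continuousOn_pi.2 fun ξ t ht => (hu.2 t ht ξ).continuousWithinAt
  obtain ⟨M₁, hM₁⟩ := isCompact_Icc.exists_bound_of_continuousOn (hcont hv)
  obtain ⟨M₂, hM₂⟩ := isCompact_Icc.exists_bound_of_continuousOn (hcont hw)
  set M := max |M₁| |M₂| with hM
  have hM0 : 0 ≤ M := (abs_nonneg _).trans (le_max_left _ _)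
  obtain ⟨K, hK, hF⟩ := hG.exists_backwardField_lipschitz hM0
  obtain ⟨L, hL, hfb⟩ := hG.exists_feedback_lipschitz
  obtain ⟨A, hA, hfA⟩ := hG.exists_norm_feedback_le M
  have key := norm_le_of_deriv_bound_backward (d := fun t => w t - v t)
    (d' := fun t ξ => -G.backwardField (G.feedback (w t)) (w t) ξ
      - -G.backwardField (G.feedback (v t)) (v t) ξ) (a := 0) (b := G.T)
    (K := K * (1 + A) + K * L) (E := 0) (lam := K * (1 + A) + K * L + 1) le_rfl (by linarith)
    (fun ξ t ht => (hw.2 t ht ξ).sub (hv.2 t ht ξ))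
    (by funext ξ; simp [hv.1 ξ, hw.1 ξ]) fun t ht ξ => ?_
  · intro t ht
    have := key t ht
    rw [zero_div, zero_mul, norm_le_zero_iff, sub_eq_zero] at this
    exact this
  · have hvM : ‖v t‖ ≤ M := (hM₁ t ht).trans ((le_abs_self _).trans (le_max_left _ _))
    have hwM : ‖w t‖ ≤ M := (hM₂ t ht).trans ((le_abs_self _).trans (le_max_right _ _))
    rw [← neg_sub', abs_neg]
    have h1 := hF (G.feedback (w t)) (G.feedback (v t)) (w t) (v t) ξ hwM hvM
    have h2 := mul_le_mul_of_nonneg_left (hfb (w t) (v t)) hK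
    have h3 : K * (1 + ‖G.feedback (v t)‖) * ‖w t - v t‖ ≤ K * (1 + A) * ‖w t - v t‖ := by
      have := hfA (v t) hvM
      gcongr
    linarith

/-- The value function against `β` is close to the equilibrium value if `β` is close to the
equilibrium feedback, in exponentially weighted norms; the constant does not depend on `β`. -/
theorem Standing.exists_value_stability (hG : G.Standing) {v : ℝ → State m N → ℝ}
    (hv : G.IsNLLSolution v) (hvM : ∀ t ∈ Icc 0 G.T, ‖v t‖ ≤ G.valueBound) :
    ∃ K : ℝ, 0 ≤ K ∧ ∀ β, G.IsAdmissible β → ∀ B lam : ℝ, 0 ≤ B → K < lam →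
      (∀ t ∈ Icc 0 G.T, ‖β t - G.feedback (v t)‖ ≤ B * Real.exp (lam * (G.T - t))) →
      ∀ t ∈ Icc 0 G.T,
        ‖G.value β t - v t‖ ≤ K * B / (lam - K) * Real.exp (lam * (G.T - t)) := by
  obtain ⟨K, hK, hF⟩ := hG.exists_backwardField_lipschitz hG.valueBound_nonneg
  obtain ⟨A, hA, hfA⟩ := hG.exists_norm_feedback_le G.valueBound
  -- `A` bounds the equilibrium feedback, the only control whose norm multiplies the difference of
  -- the values.
  refine ⟨K * (1 + A), by positivity, fun β hβ B lam hB hlam hbd => ?_⟩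
  obtain ⟨hT, hval, hvalM, -⟩ := hG.value_spec hβ
  refine norm_le_of_deriv_bound_backward (d := fun t => G.value β t - v t)
    (d' := fun t ξ => -G.backwardField (β t) (G.value β t) ξ
      - -G.backwardField (G.feedback (v t)) (v t) ξ) (by positivity) hlam
    (fun ξ t ht => (hval t ht ξ).sub (hv.2 t ht ξ))
    (by funext ξ; simp [hT, hv.1 ξ]) fun t ht ξ => ?_
  rw [← neg_sub', abs_neg]
  have h1 := hF (β t) (G.feedback (v t)) (G.value β t) (v t) ξ (hvalM t ht) (hvM t ht)
  have h2 := mul_le_mul_of_nonneg_left (hbd t ht) hK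
  have h3 : K * (1 + ‖G.feedback (v t)‖) * ‖G.value β t - v t‖ ≤
      K * (1 + A) * ‖G.value β t - v t‖ := by
    have := hfA (v t) (hvM t ht)
    gcongr
  have h4 : 0 ≤ K * A * (B * Real.exp (lam * (G.T - t))) := by positivity
  linarith

/-! ### The iteration in exponentially weighted norms -/

theorem Standing.isAdmissible_iterControl (hG : G.Standing) {ρ : ℝ} (hρ : ρ ∈ Icc (0 : ℝ) 1)
    {β₀ : ℝ → State m N → Ctrl m} (hβ₀ : G.IsAdmissible β₀) (n : ℕ) :
    G.IsAdmissible (G.iterControl ρ β₀ n) := by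
  induction n with
  | zero => exact hβ₀
  | succ n ih =>
    have hbr := (hG.value_spec ih).2.2.2
    obtain ⟨⟨K₁, hK₁⟩, hpos₁⟩ := ih
    obtain ⟨⟨K₂, hK₂⟩, hpos₂⟩ := hbr
    refine ⟨⟨‖ρ‖₊ * K₁ + ‖1 - ρ‖₊ * K₂, fun ξ =>
      ((lipschitzWith_smul ρ).comp_lipschitzOnWith (hK₁ ξ)).add
        ((lipschitzWith_smul (1 - ρ)).comp_lipschitzOnWith (hK₂ ξ))⟩, fun t ht ξ i => ?_⟩
    simp only [iterControl, PiLp.add_apply, PiLp.smul_apply, smul_eq_mul]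
    exact add_nonneg (mul_nonneg hρ.1 (hpos₁ t ht ξ i))
      (mul_nonneg (sub_nonneg.2 hρ.2) (hpos₂ t ht ξ i))

theorem norm_le_stNorm {V : Type*} [NormedAddCommGroup V] (φ : State m N → V) :
    ‖φ‖ ≤ stNorm φ := by
  refine (pi_norm_le_iff_of_nonneg (Real.sqrt_nonneg _)).2 fun ξ => Real.le_sqrt_of_sq_le ?_
  exact Finset.single_le_sum (f := fun ξ => ‖φ ξ‖ ^ 2) (fun _ _ => by positivity)
    (Finset.mem_univ ξ)

theorem stNorm_le {V : Type*} [NormedAddCommGroup V] (φ : State m N → V) :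
    stNorm φ ≤ √(Fintype.card (State m N)) * ‖φ‖ := by
  rw [stNorm, ← Real.sqrt_sq (norm_nonneg φ), ← Real.sqrt_mul (Nat.cast_nonneg _)]
  refine Real.sqrt_le_sqrt ?_
  calc ∑ ξ, ‖φ ξ‖ ^ 2 ≤ ∑ _ξ : State m N, ‖φ‖ ^ 2 := Finset.sum_le_sum fun ξ _ => by
        have := norm_le_pi_norm φ ξ
        gcongr
    _ = _ := by simp

/-- Geometric convergence of the iteration with any rate larger than the weight `ρ`. -/
theorem Standing.exists_iterValue_bound (hG : G.Standing) {v : ℝ → State m N → ℝ}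
    (hv : G.IsNLLSolution v) (hvM : ∀ t ∈ Icc 0 G.T, ‖v t‖ ≤ G.valueBound)
    (R : ℝ) {ρ q : ℝ} (hρ : ρ ∈ Icc (0 : ℝ) 1) (hq : 0 < q) :
    ∃ c : ℝ, 0 < c ∧ ∀ β₀, G.IsAdmissibleBdd R β₀ → ∀ n : ℕ, 1 ≤ n → ∀ t ∈ Icc 0 G.T,
      stNorm (fun ξ => G.iterValue ρ β₀ n t ξ - v t ξ) ≤ c * (ρ + q) ^ n := by
  obtain ⟨K, hK, hstab⟩ := hG.exists_value_stability hv hvM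
  obtain ⟨L, hL, hfb⟩ := hG.exists_feedback_lipschitz
  obtain ⟨A, hA, hfA⟩ := hG.exists_norm_feedback_le G.valueBound
  have hρ0 := hρ.1
  have hρ1 : 0 ≤ 1 - ρ := sub_nonneg.2 hρ.2
  have hT := hG.T_pos.le
  -- Chosen so that `L K / (lam - K) ≤ q`: the map from a control to its best response contracts by
  -- `q` in the weighted norm.
  set lam : ℝ := K + L * K / q + 1 with hlam
  have hlamK : K < lam := by
    have : 0 ≤ L * K / q := by positivity
    linarith
  have hlK : 0 < lam - K := sub_pos.2 hlamK
  have hlam0 : 0 ≤ lam := hK.trans hlamK.le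
  have hcontr : L * (K / (lam - K)) ≤ q := by
    rw [← mul_div_assoc, div_le_iff₀ hlK]
    have : q * (lam - K) = L * K + q := by rw [hlam]; field_simp; ring
    linarith
  set B : ℝ := |R| + A with hB
  have hB0 : 0 ≤ B := by positivity
  have hr : 0 < ρ + q := by linarith
  have hcontrol : ∀ β₀, G.IsAdmissibleBdd R β₀ → ∀ n : ℕ, ∀ t ∈ Icc 0 G.T,
      ‖G.iterControl ρ β₀ n t - G.feedback (v t)‖ ≤
        B * (ρ + q) ^ n * Real.exp (lam * (G.T - t)) := by
    intro β₀ hβ₀ n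
    induction n with
    | zero =>
      intro t ht
      have h1 : ‖β₀ t‖ ≤ |R| := (norm_le_stNorm _).trans ((hβ₀.2 t ht).trans (le_abs_self R))
      have h2 := hfA (v t) (hvM t ht)
      have h3 : 1 ≤ Real.exp (lam * (G.T - t)) :=
        Real.one_le_exp (mul_nonneg hlam0 (sub_nonneg.2 ht.2))
      rw [pow_zero, mul_one]
      exact (norm_sub_le _ _).trans ((add_le_add h1 h2).trans (le_mul_of_one_le_right hB0 h3))
    | succ n ih =>
      intro t ht
      have h1 := ih t ht
      have h2 := hstab _ (hG.isAdmissible_iterControl hρ hβ₀.1 n) (B * (ρ + q) ^ n) lam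
        (by positivity) hlamK ih t ht
      have h3 := hfb (G.value (G.iterControl ρ β₀ n) t) (v t)
      -- The equilibrium feedback is a fixed point of the averaged map, so the error is the same
      -- convex combination of the old error and the best-response error.
      have h4 : G.iterControl ρ β₀ (n + 1) t - G.feedback (v t) =
          ρ • (G.iterControl ρ β₀ n t - G.feedback (v t)) +
            (1 - ρ) • (G.feedback (G.value (G.iterControl ρ β₀ n) t) - G.feedback (v t)) := by
        have : G.iterControl ρ β₀ (n + 1) t = ρ • G.iterControl ρ β₀ n t +
          (1 - ρ) • G.feedback (G.value (G.iterControl ρ β₀ n) t) := rfl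
        rw [this]
        module
      set X : ℝ := B * (ρ + q) ^ n * Real.exp (lam * (G.T - t)) with hX
      have hX0 : 0 ≤ X := by positivity
      have h5 : ‖G.feedback (G.value (G.iterControl ρ β₀ n) t) - G.feedback (v t)‖ ≤ q * X := by
        refine h3.trans ((mul_le_mul_of_nonneg_left h2 hL).trans ?_)
        have h6 := mul_le_mul_of_nonneg_right hcontr hX0
        refine le_of_eq_of_le ?_ h6
        rw [hX]
        ring
      rw [h4]
      refine (norm_add_le _ _).trans ?_
      rw [norm_smul, norm_smul, Real.norm_of_nonneg hρ0, Real.norm_of_nonneg hρ1]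
      have h7 := mul_le_mul_of_nonneg_left h1 hρ0
      have h8 := mul_le_mul_of_nonneg_left h5 hρ1
      have h9 : 0 ≤ ρ * (q * X) := by positivity
      have h10 : B * (ρ + q) ^ (n + 1) * Real.exp (lam * (G.T - t)) = (ρ + q) * X := by
        rw [hX]; ring
      rw [h10]
      linarith
  set D : ℝ := √(Fintype.card (State m N)) * (K * B / (lam - K) * Real.exp (lam * G.T)) with hD
  have hD0 : 0 ≤ D := by positivity
  -- The division by `ρ + q` accounts for the index shift, since the `n`-th value uses control `n -
  -- 1`; the added `1` keeps the constant positive even if `D = 0`.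
  refine ⟨(D + 1) / (ρ + q), by positivity, fun β₀ hβ₀ n hn t ht => ?_⟩
  obtain ⟨k, rfl⟩ := Nat.exists_eq_add_of_le' hn
  have h1 := hstab _ (hG.isAdmissible_iterControl hρ hβ₀.1 k) (B * (ρ + q) ^ k) lam
    (by positivity) hlamK (hcontrol β₀ hβ₀ k) t ht
  have h2 : Real.exp (lam * (G.T - t)) ≤ Real.exp (lam * G.T) :=
    Real.exp_le_exp.2 (mul_le_mul_of_nonneg_left (by linarith [ht.1]) hlam0)
  calc stNorm (fun ξ => G.iterValue ρ β₀ (k + 1) t ξ - v t ξ)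
      ≤ √(Fintype.card (State m N)) * ‖G.value (G.iterControl ρ β₀ k) t - v t‖ := stNorm_le _
    _ ≤ √(Fintype.card (State m N)) *
        (K * (B * (ρ + q) ^ k) / (lam - K) * Real.exp (lam * G.T)) := by
        refine mul_le_mul_of_nonneg_left (h1.trans ?_) (Real.sqrt_nonneg _)
        exact mul_le_mul_of_nonneg_left h2 (by positivity)
    _ = D * (ρ + q) ^ k := by rw [hD]; ring
    _ ≤ (D + 1) * (ρ + q) ^ k :=
        mul_le_mul_of_nonneg_right (by linarith) (by positivity)
    _ = (D + 1) / (ρ + q) * (ρ + q) ^ (k + 1) := by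
        rw [pow_succ]; field_simp

end FiniteGame

theorem proposition3p3 (m N : ℕ) (hN : 0 < N) (G : FiniteGame m N) (hG : G.Standing) :
    ∃ v : ℝ → FiniteGame.State m N → ℝ,
      G.IsNLLSolution v ∧
      (∀ w, G.IsNLLSolution w → ∀ t ∈ Set.Icc 0 G.T, w t = v t) ∧
      (∃ γ : ℝ → ℝ,
        (∀ ρ ∈ Set.Ioo (0 : ℝ) 1, γ ρ ∈ Set.Ioo (0 : ℝ) 1) ∧
        MonotoneOn γ (Set.Ioo (0 : ℝ) 1) ∧
        Filter.Tendsto γ (nhdsWithin 0 (Set.Ioi 0)) (nhds 0) ∧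
        ∀ R : ℝ, ∀ ρ ∈ Set.Ioo (0 : ℝ) 1, ∃ c : ℝ, 0 < c ∧
          ∀ β₀, G.IsAdmissibleBdd R β₀ → ∀ n : ℕ, 1 ≤ n → ∀ t ∈ Set.Icc 0 G.T,
            FiniteGame.stNorm (fun ξ => G.iterValue ρ β₀ n t ξ - v t ξ) ≤ c * γ ρ ^ n) ∧
      (∀ R : ℝ, ∀ γ : ℝ, 0 < γ → ∃ c : ℝ, 0 < c ∧
          ∀ β₀, G.IsAdmissibleBdd R β₀ → ∀ n : ℕ, 1 ≤ n → ∀ t ∈ Set.Icc 0 G.T,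
            FiniteGame.stNorm (fun ξ => G.iterValue 0 β₀ n t ξ - v t ξ) ≤ c * γ ^ n) := by
  obtain ⟨v, hv, hvM⟩ := hG.exists_isNLLSolution
  refine ⟨v, hv, fun w hw => hG.isNLLSolution_unique hv hw,
    -- Here `q = ρ (1 - ρ)`, so that `1 - γ ρ = (1 - ρ)²` is positive, and `γ σ - γ ρ = (σ - ρ) (2 -
    -- σ - ρ)` gives monotonicity.
    ⟨fun ρ => ρ + ρ * (1 - ρ), fun ρ hρ => ?_, fun ρ hρ σ hσ h => ?_, ?_, fun R ρ hρ => ?_⟩,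
    fun R γ hγ => ?_⟩
  · have h1 := mul_pos hρ.1 (sub_pos.2 hρ.2)
    have h2 := mul_pos (sub_pos.2 hρ.2) (sub_pos.2 hρ.2)
    exact ⟨add_pos hρ.1 h1, by linarith⟩
  · have h1 := mul_nonneg (sub_nonneg.2 h) (add_nonneg (sub_nonneg.2 hρ.2.le)
      (sub_nonneg.2 hσ.2.le))
    show ρ + ρ * (1 - ρ) ≤ σ + σ * (1 - σ)
    linarith
  · have h : Continuous fun ρ : ℝ => ρ + ρ * (1 - ρ) := by fun_prop
    simpa using (h.tendsto 0).mono_left nhdsWithin_le_nhds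
  · exact hG.exists_iterValue_bound hv hvM R ⟨hρ.1.le, hρ.2.le⟩
      (mul_pos hρ.1 (sub_pos.2 hρ.2))
  · simpa only [zero_add] using
      hG.exists_iterValue_bound hv hvM R (ρ := 0) ⟨le_rfl, zero_le_one⟩ hγ
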